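/- **Setting.** For probability measures $\mu,\nu$ on $\mathbb R$ let $\mathrm{TV}(\mu,\nu)=\sup_A|\mu(A)-\nu(A)|$, the supremum over measurable $A$. Say that $\mu$ has an $\ell$-Lipschitz PDF if $\mu$ has a density $p$ with $|p(x)-p(y)|\le \ell|x-y|$ for all $x,y\in\mathbb R$; that $\mu$ is $\sigma$-sub-Gaussian if $\Pr_{X\sim\mu}[|X-\mathbb E X|\ge t]\le 2e^{-t^2/\sigma^2}$ for all $t\ge 0$; and that $\mu$ is $\alpha$-sub-Weibull with constant $c_\alpha$ if $\Pr_{X\sim\mu}[|X|\ge t]\le c_\alpha e^{-t^{1/\alpha}}$ for all $t\ge0$. Here $\sigma,\ell,\alpha,c_\alpha>0$. **Algorithm.** A Misra–Gries summary with $k$ counters stores a set $T$ of at most $k$ items, each with a counter. An incoming item $i$ of weight $\Delta$ is processed as follows. If $i\in T$, its counter is increased by $\Delta$. If $i\notin T$ and $|T|<k$, $i$ is added to $T$ with counter $\Delta$. Otherwise let $d$ be the $\lfloor k/2\rfloor$-th largest stored counter: $d$ is subtracted from all counters, items whose counters become $\le 0$ leave $T$, and if $\Delta\ge d$ then $i$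 is added to $T$ with counter $\Delta-d$. The estimated frequency $\hat f_i$ is the counter of $i$ if $i\in T$, and $0$ otherwise; $\hat C_j=\sum_{i\le j}\hat f_i$. SPA with bucket width $b$ and reference point $x_0\in\mathbb R$ starts from $T=\emptyset$ and feeds each stream element $x$, as one occurrence (weight $1$) of the bucket index $\lfloor (x-x_0)/b\rfloor$, to such a summary, and learns the bucket masses $\hat p(i)=\hat f_i/\max_j\hat C_j$. $\mathrm{STVA}$ runs SPA with the same $b,x_0,k$ on a stream from $\mu$ and on a stream from $\nu$, obtaining $\hat p_\mu,\hat p_\nu$, and returns $\widehat{\mathrm{TV}}=\frac12\sum_i|\hat p_\mu(i)-\hat p_\nu(i)|$, the sum being over the buckets with $\max\{\hat p_\mu(i),\hat p_\nu(i)\}>0$. **Theorem (PAC guarantee of STVA).** In each of the two cases below there are constants $C_n,C_k>0$, universal in case (a) and depending only on $\alpha,c_\alpha$ in case (b), such that the following holds for all $\varepsilon\in(0,1/6]$, $\delta\in(0,1/4]$, $x_0\in\mathbb R$. Let $\mu,\nu$ have $\ell_\mu$- and $\ell_\nu$-Lipschitz PDFs, let $\ell=\max\{\ell_\mu,\ell_\nu\}$,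 and let $n\ge C_n N$. Run STVA with width $b$ and $k=\lceil C_kK\rceil$ on a stream of $n$ i.i.d. samples from $\mu$ and a stream of $n$ i.i.d. samples from $\nu$ (the two streams need not be independent of each other). Then STVA never stores more than $k$ counters per stream, and $$\Pr\big[\,|\widehat{\mathrm{TV}}-\mathrm{TV}(\mu,\nu)|\ge 6\varepsilon\,\big]\le 4\delta .$$ (a) $\mu$ is $\sigma_\mu$-sub-Gaussian, $\nu$ is $\sigma_\nu$-sub-Gaussian, $\sigma=\max\{\sigma_\mu,\sigma_\nu\}$, and $$N=\varepsilon^{-2}\max\Big\{\tfrac{\sigma^2\ell\log(1/\varepsilon)}{\varepsilon},\log\tfrac1\delta\Big\},\quad K=\tfrac{\sigma^2\ell}{\varepsilon}\log\tfrac1\varepsilon,\quad b=\frac{\varepsilon}{\sigma\ell\sqrt{\log(2/\varepsilon)}} .$$ (b) $\mu,\nu$ are $\alpha$-sub-Weibull with constant $c_\alpha$, and $$N=\varepsilon^{-2}\max\Big\{\tfrac{\ell(\log(1/\varepsilon))^\alpha}{\varepsilon}\Gamma(1+\alpha),\log\tfrac1\delta\Big\},\quad K=\tfrac{\ell}{\varepsilon}\big(\log\tfrac1\varepsilon\big)^{2\alpha},\quad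 b=\frac{\varepsilon}{\ell(\log(2c_\alpha/\varepsilon))^{\alpha}} .$$ Consequently the error is $\tilde O(n^{-1/3})$ with $\tilde O(n^{1/3})$ space. For given $\sigma,\ell$ in case (a), resp. $\alpha,c_\alpha,\ell$ in case (b), there are $A,B>0$ such that for every $\delta\in(0,1/4]$ there is $n_0$ such that for all $n\ge n_0$ the following holds. Put $\varepsilon_n=A(\log n/n)^{1/3}$ in case (a), resp. $\varepsilon_n=A((\log n)^\alpha/n)^{1/3}$ in case (b). Then $\varepsilon_n\in(0,1/6]$. Moreover, for all $\mu,\nu$ as in the respective case (with common parameters $\sigma,\ell$, resp. $\alpha,c_\alpha,\ell$), STVA run as above with $\varepsilon=\varepsilon_n$ on streams of length $n$ has error less than $6\varepsilon_n$ with probability at least $1-4\delta$. It uses at most $k\le Bn^{1/3}(\log n)^{2/3}$ counters per stream in case (a), resp. at most $k\le Bn^{1/3}(\log n)^{5\alpha/3}$ in case (b). -/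

import Mathlib

open MeasureTheory ProbabilityTheory

universe u

noncomputable section

/-! ### Distributions and total variation distance -/

/-- Total variation distance `sup_A |μ(A) - ν(A)|` over measurable sets (the family is bounded by
`1` for probability measures). -/
def tvDist (μ ν : Measure ℝ) : ℝ :=
  ⨆ A : {A : Set ℝ // MeasurableSet A}, |μ.real A - ν.real A|

/-- `μ` has a probability density on the real line that is `ℓ`-Lipschitz. -/
def HasLipschitzPDF (μ : Measure ℝ) (ℓ : ℝ) : Prop :=
  ∃ p : ℝ → ℝ, (∀ x, 0 ≤ p x) ∧ (∀ x y, |p x - p y| ≤ ℓ * |x - y|) ∧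
    μ = volume.withDensity (fun x => ENNReal.ofReal (p x))

/-- `μ` is `σ`-sub-Gaussian: `P[|X - E X| ≥ t] ≤ 2 exp(-t² / σ²)` for all `t ≥ 0`. -/
def IsSubGaussian (μ : Measure ℝ) (σ : ℝ) : Prop :=
  ∀ t : ℝ, 0 ≤ t → μ.real {x | t ≤ |x - ∫ y, y ∂μ|} ≤ 2 * Real.exp (-(t ^ 2 / σ ^ 2))

/-- `μ` is `α`-sub-Weibull with constant `c`: `P[|X| ≥ t] ≤ c exp(-t^(1/α))` for all `t ≥ 0`. -/
def IsSubWeibull (μ : Measure ℝ) (α c : ℝ) : Prop :=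
  ∀ t : ℝ, 0 ≤ t → μ.real {x | t ≤ |x|} ≤ c * Real.exp (-(t ^ (1 / α)))

/-- `X 0, …, X (n-1)` are i.i.d. samples from `μ`. -/
structure IsIIDSample {Ω : Type*} [MeasurableSpace Ω] (P : Measure Ω) {n : ℕ}
    (X : Fin n → Ω → ℝ) (μ : Measure ℝ) : Prop where
  indep : iIndepFun X P
  law : ∀ i, HasLaw (X i) μ P

/-! ### The mergeable Misra–Gries summary -/

/-- State of a Misra–Gries summary over a universe `U`: the set of items that are assigned a
counter, and the counter values (`0` for items without a counter). -/
structure MMG (U : Type*) where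
  tracked : Finset U
  counter : U → ℕ

namespace MMG

variable {U : Type*} [DecidableEq U]

/-- The empty summary. -/
def init : MMG U := ⟨∅, fun _ => 0⟩

/-- The `r`-th largest value, counting multiplicity, among the stored counters: the greatest `v`
such that at least `r` of the stored counters are `≥ v`. -/
def nthLargest (s : MMG U) (r : ℕ) : ℕ :=
  Nat.findGreatest (fun v => r ≤ (s.tracked.filter (fun j => v ≤ s.counter j)).card)
    (s.tracked.sup s.counter)

/-- Subtract `d` from every stored counter and release the counters that drop to `0` or below
(subtraction on `ℕ` is truncated, so that a released counter is reset to `0`). -/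
def decrement (s : MMG U) (d : ℕ) : MMG U :=
  ⟨s.tracked.filter (fun j => d < s.counter j), fun j => s.counter j - d⟩

/-- Process the item `i` with weight `w`, using at most `k` counters; when all counters are taken,
all of them are decreased by the `⌊k/2⌋`-th largest one. -/
def update (k : ℕ) (s : MMG U) (i : U) (w : ℕ) : MMG U :=
  if i ∈ s.tracked then
    ⟨s.tracked, Function.update s.counter i (s.counter i + w)⟩
  else if s.tracked.card < k then
    ⟨insert i s.tracked, Function.update s.counter i w⟩
  else
    let d := s.nthLargest (k / 2)
    let s' := s.decrement d
    if d ≤ w then ⟨insert i s'.tracked, Function.update s'.counter i (w - d)⟩ else s'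

/-- The estimated frequency of the item `i`. -/
def estimate (s : MMG U) (i : U) : ℕ :=
  if i ∈ s.tracked then s.counter i else 0

/-- The estimated cumulative frequency of the items up to `i`. -/
def estimateCumulate [LinearOrder U] (s : MMG U) (i : U) : ℕ :=
  ∑ j ∈ s.tracked.filter (fun j => j ≤ i), s.estimate j

end MMG

/-! ### The sublinear PDF learner and the sublinear TV estimator -/

/-- Index of the bucket `[x₀ + i b, x₀ + (i+1) b)` that contains `x`. -/
def bucket (b x₀ x : ℝ) : ℤ := ⌊(x - x₀) / b⌋

/-- The summary of a stream of reals kept by the PDF learner: every element is fed to a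
Misra–Gries summary with `k` counters as one occurrence of its bucket. -/
def spaSummary (k : ℕ) (b x₀ : ℝ) (stream : List ℝ) : MMG ℤ :=
  stream.foldl (fun s x => s.update k (bucket b x₀ x) 1) MMG.init

/-- The learned mass of bucket `i`: estimated frequency divided by the maximal estimated
cumulative frequency (a maximum over a bounded set of natural numbers). -/
def spaPDF (s : MMG ℤ) (i : ℤ) : ℝ :=
  (s.estimate i : ℝ) / ((⨆ j : ℤ, s.estimateCumulate j : ℕ) : ℝ)

/-- The estimate returned by the TV estimator from its two summaries; buckets without a counter
have learned mass `0`. -/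
def stvaOutput (s t : MMG ℤ) : ℝ :=
  1 / 2 * ∑ i ∈ s.tracked ∪ t.tracked,
    if 0 < max (spaPDF s i) (spaPDF t i) then |spaPDF s i - spaPDF t i| else 0

/-- The TV estimator with bucket width `b` and `k` counters per stream, run on two streams. -/
def stva (k : ℕ) (b x₀ : ℝ) (streamX streamY : List ℝ) : ℝ :=
  stvaOutput (spaSummary k b x₀ streamX) (spaSummary k b x₀ streamY)

/-! ### Parameters -/

/-- Bucket width for `σ`-sub-Gaussian distributions. -/
def widthSG (ε σ ℓ : ℝ) : ℝ := ε / (σ * ℓ * √(Real.log (2 / ε)))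

/-- Number of counters for `σ`-sub-Gaussian distributions, with multiplicative constant `C`. -/
def countersSG (C ε σ ℓ : ℝ) : ℕ := ⌈C * (σ ^ 2 * ℓ / ε * Real.log (1 / ε))⌉₊

/-- Sample-size threshold for `σ`-sub-Gaussian distributions, up to a multiplicative constant. -/
def samplesSG (ε σ ℓ δ : ℝ) : ℝ :=
  1 / ε ^ 2 * max (σ ^ 2 * ℓ * Real.log (1 / ε) / ε) (Real.log (1 / δ))

/-- Bucket width for `α`-sub-Weibull distributions with constant `c`. -/
def widthSW (ε α c ℓ : ℝ) : ℝ := ε / (ℓ * (Real.log (2 * c / ε)) ^ α)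

/-- Number of counters for `α`-sub-Weibull distributions, with multiplicative constant `C`. -/
def countersSW (C ε α ℓ : ℝ) : ℕ := ⌈C * (ℓ / ε * (Real.log (1 / ε)) ^ (2 * α))⌉₊

/-- Sample-size threshold for `α`-sub-Weibull distributions, up to a multiplicative constant. -/
def samplesSW (ε α ℓ δ : ℝ) : ℝ :=
  1 / ε ^ 2 *
    max (ℓ * (Real.log (1 / ε)) ^ α / ε * Real.Gamma (1 + α)) (Real.log (1 / δ))

/-- The guarantee: run on the samples `X` and `Y`, the TV estimator never stores more than `k`
counters for either stream, at any time and for any outcome, and its output deviates from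
`TV(μ, ν)` by `6 ε` or more with probability at most `4 δ`. -/
def STVAGuarantee {Ω : Type*} [MeasurableSpace Ω] (P : Measure Ω) {n : ℕ}
    (X Y : Fin n → Ω → ℝ) (μ ν : Measure ℝ) (k : ℕ) (b x₀ ε δ : ℝ) : Prop :=
  (∀ ω, ∀ m ≤ n,
    (spaSummary k b x₀ ((List.ofFn fun i => X i ω).take m)).tracked.card ≤ k ∧
    (spaSummary k b x₀ ((List.ofFn fun i => Y i ω).take m)).tracked.card ≤ k) ∧
  P.real {ω | 6 * ε ≤
    |stva k b x₀ (List.ofFn fun i => X i ω) (List.ofFn fun i => Y i ω) - tvDist μ ν|} ≤ 4 * δ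

end

/-!
The estimation error splits into a discretisation error, a sampling error and the error of the
Misra–Gries summaries.

*Discretisation.* Only the buckets meeting an interval of radius `R` that carries mass `1 - ε` of `μ`
matter. In a bucket of width `b` the difference of the two densities either keeps its sign, and
nothing is lost, or vanishes somewhere, and then it is at most `2 ℓ b`; so a bucket costs at most
`ℓ b²` (`HasLipschitzPDF.measureReal_inter_Ico_sub_le`). There are at most `2 R / b + 2` such
buckets, and `b` is chosen with `ℓ b R = ε`. Since an `ℓ`-Lipschitz density is bounded by `√ℓ`, the
interval cannot be too short: `ε ≤ ℓ R²`, that is, `b ≤ R` (`HasLipschitzPDF.le_mul_sq`). The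
discretisation error is therefore at most `2 ε + 2 ε + ε`. The constants in `n` and `k` do not
influence it, and they make the remaining errors small compared with `ε`.

*Summaries.* Every decrement by `d` removes `d` from at least `⌊k/2⌋` counters. If `H` is a set of at
most `k / 4` buckets, then at least half of these counters lie outside `H`, so that the stream
elements outside `H` pay for all decrements, and the counters account for all but twice as many
stream elements (`MMG.length_le_sum_counter_add`). For `H` the buckets that meet a slightly larger
interval, of mass `1 - ε / 16`, are taken.

*Sampling.* The `ℓ¹` distance on `H` between empirical frequencies and bucket masses has mean at most
`∑ √(p i / n)`, and by the bounded differences inequality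
(`hasSubgaussianMGF_pi_of_boundedDifferences`) it concentrates around its mean at scale `1 / √n`.
For sub-Gaussian distributions `∑ √(p i) ≤ √|H|` suffices. For sub-Weibull distributions the sample
size is smaller than `|H| / ε²` by a power of the logarithm; there `∑ √(p i)` is bounded by a constant
multiple of `b ^ (-1/2)`, independently of `H`, by the Cauchy–Schwarz inequality with quadratically
growing weights and a bound on the second moment (`sum_sqrt_bucketMass_le`).

The error rate for streams of length `n` follows by solving the sample size condition for `ε`.
-/

/-! ### Deterministic guarantees of the Misra–Gries summary -/

theorem sum_count_add_countP_notMem {α : Type*} [DecidableEq α] (l : List α) (G : Finset α) :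
    ∑ i ∈ G, l.count i + l.countP (fun x => x ∉ G) = l.length := by
  induction l with
  | nil => simp
  | cons a l ih =>
    simp only [List.countP_cons, List.count_cons, Finset.sum_add_distrib, List.length_cons, ← ih]
    by_cases ha : a ∈ G <;> simp [ha] <;> omega

namespace MMG

variable {U : Type*}

theorem le_card_nthLargest_le {s : MMG U} {r : ℕ} (h : r ≤ s.tracked.card) :
    r ≤ (s.tracked.filter (fun j => s.nthLargest r ≤ s.counter j)).card := by
  unfold nthLargest
  refine Nat.findGreatest_spec
    (P := fun v => r ≤ (s.tracked.filter (fun j => v ≤ s.counter j)).card) (Nat.zero_le _) ?_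
  simpa using h

theorem card_nthLargest_lt_lt {s : MMG U} {r : ℕ} (hr : 0 < r) :
    (s.tracked.filter (fun j => s.nthLargest r < s.counter j)).card < r := by
  rcases lt_or_ge (s.nthLargest r) (s.tracked.sup s.counter) with h | h
  · have := Nat.findGreatest_is_greatest
      (P := fun v => r ≤ (s.tracked.filter (fun j => v ≤ s.counter j)).card)
      (n := s.tracked.sup s.counter) (k := s.nthLargest r + 1) (Nat.lt_succ_self _) h
    simpa [Nat.succ_le_iff] using this
  · rw [Finset.filter_false_of_mem]
    · simpa using hr
    · intro j hj
      have := Finset.le_sup (f := s.counter) hj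
      omega

theorem filter_nthLargest_zero (s : MMG U) :
    s.tracked.filter (fun j => s.nthLargest 0 < s.counter j) = ∅ := by
  have h : s.nthLargest 0 = s.tracked.sup s.counter := by
    unfold nthLargest
    simp [Nat.findGreatest_eq]
  rw [Finset.filter_false_of_mem]
  intro j hj
  have := Finset.le_sup (f := s.counter) hj
  omega

theorem card_decrement_nthLargest_le (s : MMG U) (r : ℕ) :
    (s.decrement (s.nthLargest r)).tracked.card ≤ r - 1 := by
  rcases Nat.eq_zero_or_pos r with rfl | hr
  · simp [decrement, filter_nthLargest_zero]
  · have := card_nthLargest_lt_lt (s := s) hr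
    simp only [decrement]
    omega

variable [DecidableEq U]

theorem card_tracked_update_le {k : ℕ} (hk : 0 < k) {s : MMG U} (hs : s.tracked.card ≤ k)
    (i : U) (w : ℕ) : (s.update k i w).tracked.card ≤ k := by
  have hd := card_decrement_nthLargest_le s (k / 2)
  unfold update
  split_ifs with h1 h2
  · exact hs
  · exact (Finset.card_insert_le _ _).trans h2
  · dsimp only
    split_ifs
    · refine (Finset.card_insert_le _ _).trans ?_
      omega
    · omega

/-- The summary of a stream of items, each of weight one. -/
def run (k : ℕ) (l : List U) : MMG U := l.foldl (fun s i => s.update k i 1) init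

theorem run_append_singleton (k : ℕ) (l : List U) (i : U) :
    run k (l ++ [i]) = (run k l).update k i 1 := by
  simp [run]

theorem card_tracked_run_le {k : ℕ} (hk : 0 < k) (l : List U) : (run k l).tracked.card ≤ k := by
  induction l using List.reverseRecOn with
  | nil => simp [run, init]
  | append_singleton l i ih =>
    rw [run_append_singleton]
    exact card_tracked_update_le hk ih i 1

/-- The error invariant of a summary `s` of the stream `l` after decrements of total size `E`:
no frequency is overestimated, none is underestimated by more than `E`, and, for any set `H` of
items, the stream elements outside `H` pay for all decrements of the counters outside `H`, of which
there are at least `⌊k/2⌋ - |H|` at a time. -/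
structure ErrorBound (k : ℕ) (l : List U) (s : MMG U) (E : ℕ) : Prop where
  estimate_le : ∀ i, s.estimate i ≤ l.count i
  le_estimate : ∀ i, l.count i ≤ s.estimate i + E
  decrement_le : ∀ H : Finset U,
    E * (k / 2) + ∑ j ∈ s.tracked \ H, s.counter j ≤ E * H.card + l.countP (fun x => x ∉ H)

/-- The counters outside `H` that are at least `d` absorb the whole decrement by `d`. -/
theorem sum_decrement_le {s : MMG U} {d r : ℕ}
    (hd : r ≤ (s.tracked.filter (fun j => d ≤ s.counter j)).card) (H : Finset U) :
    d * r + ∑ j ∈ (s.decrement d).tracked \ H, (s.counter j - d) ≤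
      d * H.card + ∑ j ∈ s.tracked \ H, s.counter j := by
  have h1 : ∑ j ∈ (s.decrement d).tracked \ H, (s.counter j - d) ≤
      ∑ j ∈ s.tracked \ H, (s.counter j - d) := by
    apply Finset.sum_le_sum_of_subset
    exact Finset.sdiff_subset_sdiff (Finset.filter_subset _ _) le_rfl
  have h2 : d * ((s.tracked \ H).filter (fun j => d ≤ s.counter j)).card +
      ∑ j ∈ s.tracked \ H, (s.counter j - d) ≤ ∑ j ∈ s.tracked \ H, s.counter j := by
    have : d * ((s.tracked \ H).filter (fun j => d ≤ s.counter j)).card =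
        ∑ j ∈ s.tracked \ H, if d ≤ s.counter j then d else 0 := by
      rw [← Finset.sum_filter, Finset.sum_const, smul_eq_mul, mul_comm]
    rw [this, ← Finset.sum_add_distrib]
    apply Finset.sum_le_sum
    intro j _
    split_ifs <;> omega
  have h3 : r ≤ H.card + ((s.tracked \ H).filter (fun j => d ≤ s.counter j)).card := by
    refine hd.trans ((Finset.card_le_card ?_).trans (Finset.card_union_le _ _))
    intro j hj
    simp only [Finset.mem_filter, Finset.mem_union, Finset.mem_sdiff] at hj ⊢
    tauto
  have h4 := Nat.mul_le_mul_left d h3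
  rw [mul_add] at h4
  omega

theorem errorBound_init (k : ℕ) : ErrorBound k [] (init : MMG U) 0 where
  estimate_le := by simp [init, estimate]
  le_estimate := by simp
  decrement_le := by simp [init]

theorem ErrorBound.update {k : ℕ} {l : List U} {s : MMG U} {E : ℕ} (h : ErrorBound k l s E)
    (i : U) : ∃ E', ErrorBound k (l ++ [i]) (s.update k i 1) E' := by
  have hcount : ∀ j, (l ++ [i]).count j = l.count j + if i = j then 1 else 0 := by
    intro j; simp [List.count_singleton]
  have hcountP : ∀ H : Finset U, (l ++ [i]).countP (fun x => x ∉ H) =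
      l.countP (fun x => x ∉ H) + if i ∈ H then 0 else 1 := by
    intro H; by_cases hi : i ∈ H <;> simp [hi]
  by_cases h1 : i ∈ s.tracked
  · refine ⟨E, ?_, ?_, ?_⟩
    · intro j
      have := h.estimate_le j
      rw [hcount]
      simp only [MMG.update, if_pos h1, estimate, Function.update_apply] at this ⊢
      grind
    · intro j
      have := h.le_estimate j
      rw [hcount]
      simp only [MMG.update, if_pos h1, estimate, Function.update_apply] at this ⊢
      grind
    · intro H
      have := h.decrement_le H
      rw [hcountP]
      simp only [MMG.update, if_pos h1]
      by_cases hi : i ∈ H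
      · rw [Finset.sum_update_of_notMem (by simp [hi])]
        simpa [hi] using this
      · have hm : i ∈ s.tracked \ H := by simp [h1, hi]
        rw [Finset.sum_update_of_mem hm]
        rw [← Finset.add_sum_erase _ _ hm, Finset.erase_eq] at this
        simp only [hi, if_false]
        omega
  by_cases h2 : s.tracked.card < k
  · have h0 : l.count i ≤ E := by simpa [estimate, h1] using h.le_estimate i
    refine ⟨E, ?_, ?_, ?_⟩
    · intro j
      have := h.estimate_le j
      rw [hcount]
      simp only [MMG.update, if_neg h1, if_pos h2, estimate, Function.update_apply] at this ⊢
      grind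
    · intro j
      have := h.le_estimate j
      rw [hcount]
      simp only [MMG.update, if_neg h1, if_pos h2, estimate, Function.update_apply] at this ⊢
      grind
    · intro H
      have := h.decrement_le H
      rw [hcountP]
      simp only [MMG.update, if_neg h1, if_pos h2]
      by_cases hi : i ∈ H
      · rw [Finset.insert_sdiff_of_mem _ hi, Finset.sum_update_of_notMem (by simp [hi])]
        simpa [hi] using this
      · rw [Finset.insert_sdiff_of_notMem _ hi, Finset.sum_insert (by simp [h1]),
          Finset.sum_update_of_notMem (by simp [h1])]
        simp only [hi, if_false, Function.update_self]
        omega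
  · obtain ⟨d, hd⟩ : ∃ d, d = s.nthLargest (k / 2) := ⟨_, rfl⟩
    have hr : k / 2 ≤ (s.tracked.filter (fun j => d ≤ s.counter j)).card := by
      rw [hd]; exact le_card_nthLargest_le (by omega)
    have h0 : l.count i ≤ E := by simpa [estimate, h1] using h.le_estimate i
    -- The arriving item occurs at most `E` times before, so that whether or not it gets a counter,
    -- its error is at most `E + d`.
    refine ⟨E + d, ?_, ?_, ?_⟩
    · intro j
      have := h.estimate_le j
      rw [hcount]
      simp only [estimate] at this
      by_cases h3 : d ≤ 1
      · simp only [MMG.update, if_neg h1, if_neg h2, estimate, ← hd, if_pos h3, decrement,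
          Function.update_apply, Finset.mem_insert, Finset.mem_filter]
        clear hcount hcountP hd hr
        rcases eq_or_ne j i with rfl | hji
        · simp [h1] at *; omega
        · simp only [hji, hji.symm, if_false, false_or]
          split_ifs at this ⊢ <;> first | omega | grind
      · simp only [MMG.update, if_neg h1, if_neg h2, estimate, ← hd, if_neg h3, decrement,
          Finset.mem_filter]
        clear hcount hcountP hd hr
        rcases eq_or_ne j i with rfl | hji
        · simp [h1] at *; try omega
        · simp only [hji.symm, if_false]
          split_ifs at this ⊢ <;> first | omega | grind
    · intro j
      have := h.le_estimate j
      rw [hcount]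
      simp only [estimate] at this
      by_cases h3 : d ≤ 1
      · simp only [MMG.update, if_neg h1, if_neg h2, estimate, ← hd, if_pos h3, decrement,
          Function.update_apply, Finset.mem_insert, Finset.mem_filter]
        clear hcount hcountP hd hr
        rcases eq_or_ne j i with rfl | hji
        · simp [h1] at *; omega
        · simp only [hji, hji.symm, if_false, false_or]
          split_ifs at this ⊢ <;> first | omega | grind
      · simp only [MMG.update, if_neg h1, if_neg h2, estimate, ← hd, if_neg h3, decrement,
          Finset.mem_filter]
        clear hcount hcountP hd hr
        rcases eq_or_ne j i with rfl | hji
        · simp [h1] at *; try omega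
        · simp only [hji.symm, if_false]
          split_ifs at this ⊢ <;> first | omega | grind
    · intro H
      have hH := h.decrement_le H
      have hs := sum_decrement_le hr H
      rw [hcountP]
      simp only [MMG.update, if_neg h1, if_neg h2, ← hd]
      have hi' : i ∉ (s.decrement d).tracked := by simp [decrement, h1]
      have key : (E + d) * (k / 2) + ∑ j ∈ (s.decrement d).tracked \ H, (s.counter j - d) ≤
          (E + d) * H.card + l.countP (fun x => x ∉ H) := by
        rw [add_mul, add_mul]; omega
      split_ifs with h3 hi hi
      · dsimp only
        rw [Finset.insert_sdiff_of_mem _ hi, Finset.sum_update_of_notMem (by simp [hi])]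
        simpa [decrement] using key
      · dsimp only
        rw [Finset.insert_sdiff_of_notMem _ hi, Finset.sum_insert (by simp [hi']),
          Finset.sum_update_of_notMem (by simp [hi'])]
        simp only [Function.update_self, decrement] at key ⊢
        omega
      · simpa [decrement] using key
      · exact Nat.le_succ_of_le (by simpa [decrement] using key)

theorem exists_errorBound_run (k : ℕ) (l : List U) : ∃ E, ErrorBound k l (run k l) E := by
  induction l using List.reverseRecOn with
  | nil => exact ⟨0, errorBound_init k⟩
  | append_singleton l i ih =>
    obtain ⟨E, hE⟩ := ih
    rw [run_append_singleton]
    exact hE.update i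

theorem estimate_run_le_count (k : ℕ) (l : List U) (i : U) :
    (run k l).estimate i ≤ l.count i := by
  obtain ⟨E, hE⟩ := exists_errorBound_run k l
  exact hE.estimate_le i

/-- If a set of few items is missed by only `t` stream elements, then the counters account for all
but `2 t` elements of the stream. -/
theorem length_le_sum_counter_add (k : ℕ) (l : List U) (H : Finset U) (hH : 2 * H.card ≤ k / 2) :
    l.length ≤ ∑ j ∈ (run k l).tracked, (run k l).counter j +
      2 * l.countP (fun x => x ∉ H) := by
  obtain ⟨E, hE⟩ := exists_errorBound_run k l
  have h1 : E * H.card ≤ l.countP (fun x => x ∉ H) := by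
    have h := hE.decrement_le H
    have h' := Nat.mul_le_mul_left E hH
    have : E * (2 * H.card) = E * H.card + E * H.card := by ring
    omega
  have h2 : l.length = ∑ i ∈ H, l.count i + l.countP (fun x => x ∉ H) :=
    (sum_count_add_countP_notMem l H).symm
  have h3 : ∑ i ∈ H, l.count i ≤ ∑ i ∈ H, (run k l).estimate i + E * H.card := by
    calc ∑ i ∈ H, l.count i ≤ ∑ i ∈ H, ((run k l).estimate i + E) :=
          Finset.sum_le_sum fun i _ => hE.le_estimate i
      _ = _ := by simp [Finset.sum_add_distrib, mul_comm]
  have h4 : ∑ i ∈ H, (run k l).estimate i ≤ ∑ j ∈ (run k l).tracked, (run k l).counter j := by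
    simp only [estimate]
    rw [← Finset.sum_filter]
    apply Finset.sum_le_sum_of_subset
    intro j
    simp
  omega

end MMG

/-! ### Accuracy of the learned bucket masses -/

theorem spaSummary_eq_run (k : ℕ) (b x₀ : ℝ) (stream : List ℝ) :
    spaSummary k b x₀ stream = MMG.run k (stream.map (bucket b x₀)) := by
  simp [spaSummary, MMG.run, List.foldl_map]

/-- The maximal estimated cumulative frequency is the sum of all counters. -/
theorem iSup_estimateCumulate (s : MMG ℤ) :
    (⨆ j : ℤ, s.estimateCumulate j) = ∑ j ∈ s.tracked, s.counter j := by
  have hle : ∀ j, s.estimateCumulate j ≤ ∑ j ∈ s.tracked, s.counter j := by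
    intro j
    refine (Finset.sum_le_sum_of_subset (Finset.filter_subset _ _)).trans (Finset.sum_le_sum ?_)
    intro i hi
    simp [MMG.estimate, hi]
  apply le_antisymm (ciSup_le hle)
  obtain ⟨M, hM⟩ := s.tracked.bddAbove
  refine le_trans ?_ (le_ciSup ⟨_, Set.forall_mem_range.2 hle⟩ M)
  unfold MMG.estimateCumulate
  rw [Finset.filter_true_of_mem fun j hj => hM hj]
  refine Finset.sum_le_sum fun j hj => ?_
  simp [MMG.estimate, hj]

theorem spaPDF_eq (s : MMG ℤ) (i : ℤ) :
    spaPDF s i = (s.estimate i : ℝ) / ((∑ j ∈ s.tracked, s.counter j : ℕ) : ℝ) := by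
  rw [spaPDF, iSup_estimateCumulate]

theorem spaPDF_eq_zero_of_notMem {s : MMG ℤ} {i : ℤ} (hi : i ∉ s.tracked) : spaPDF s i = 0 := by
  simp [spaPDF_eq, MMG.estimate, hi]

theorem spaPDF_nonneg (s : MMG ℤ) (i : ℤ) : 0 ≤ spaPDF s i := by
  rw [spaPDF]; positivity

theorem stvaOutput_eq {s t : MMG ℤ} {G : Finset ℤ} (hs : s.tracked ⊆ G) (ht : t.tracked ⊆ G) :
    stvaOutput s t = 1 / 2 * ∑ i ∈ G, |spaPDF s i - spaPDF t i| := by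
  unfold stvaOutput
  rw [← Finset.sum_subset (Finset.union_subset hs ht)]
  · congr 1
    refine Finset.sum_congr rfl fun i _ => ?_
    have h1 := spaPDF_nonneg s i
    have h2 := spaPDF_nonneg t i
    split_ifs with h
    · rfl
    · have h3 := max_le_iff.1 (not_lt.1 h)
      rw [le_antisymm h3.1 h1, le_antisymm h3.2 h2]
      simp
  · intro i _ hi
    simp only [Finset.mem_union, not_or] at hi
    simp [spaPDF_eq_zero_of_notMem hi.1, spaPDF_eq_zero_of_notMem hi.2]

/-- The learned masses differ from the empirical frequencies by the fraction of the stream that the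
counters miss. -/
theorem sum_abs_spaPDF_sub_le {k : ℕ} {l : List ℤ} {H : Finset ℤ} (hl : l ≠ [])
    (hH : 2 * H.card ≤ k / 2) (hS : 2 * l.countP (fun x => x ∉ H) < l.length)
    {G : Finset ℤ} (hG : (MMG.run k l).tracked ⊆ G) :
    ∑ i ∈ G, |spaPDF (MMG.run k l) i - l.count i / l.length| ≤
      4 * (l.countP (fun x => x ∉ H) / l.length) := by
  obtain ⟨s, hs⟩ : ∃ s, s = MMG.run k l := ⟨_, rfl⟩
  have hmain := MMG.length_le_sum_counter_add k l H hH
  have hest : ∀ i, (s.estimate i : ℝ) ≤ l.count i := fun i => by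
    rw [hs]; exact_mod_cast MMG.estimate_run_le_count k l i
  rw [← hs] at hmain hG ⊢
  obtain ⟨S, hSd⟩ : ∃ S, S = ∑ j ∈ s.tracked, s.counter j := ⟨_, rfl⟩
  rw [← hSd] at hmain
  have hn : (0 : ℝ) < l.length := by exact_mod_cast List.length_pos_iff.2 hl
  have hS0 : (0 : ℝ) < S := by
    have : 0 < S := by omega
    exact_mod_cast this
  have hsum : ∑ i ∈ G, (s.estimate i : ℝ) = S := by
    rw [hSd, Nat.cast_sum, ← Finset.sum_subset hG]
    · exact Finset.sum_congr rfl fun i hi => by simp [MMG.estimate, hi]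
    · intro i _ hi; simp [MMG.estimate, hi]
  have hcnt : ∑ i ∈ G, (l.count i : ℝ) ≤ l.length := by
    have := sum_count_add_countP_notMem l G
    have h : ∑ i ∈ G, l.count i ≤ l.length := by omega
    exact_mod_cast h
  have hSn : (S : ℝ) ≤ l.length := by
    rw [← hsum]; exact (Finset.sum_le_sum fun i _ => hest i).trans hcnt
  have hpt : ∀ i ∈ G, |spaPDF s i - l.count i / l.length| ≤
      (s.estimate i / S - s.estimate i / l.length) +
        (l.count i / l.length - s.estimate i / l.length) := by
    intro i _
    rw [spaPDF_eq, ← hSd]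
    have h1 : (s.estimate i : ℝ) / l.length ≤ s.estimate i / S :=
      div_le_div_of_nonneg_left (by positivity) hS0 hSn
    have h2 : (s.estimate i : ℝ) / l.length ≤ l.count i / l.length := by
      exact div_le_div_of_nonneg_right (hest i) hn.le
    rw [abs_le]; constructor <;> linarith
  refine (Finset.sum_le_sum hpt).trans ?_
  rw [Finset.sum_add_distrib, Finset.sum_sub_distrib, Finset.sum_sub_distrib, ← Finset.sum_div,
    ← Finset.sum_div, ← Finset.sum_div, hsum, div_self hS0.ne']
  have h3 : (l.length : ℝ) ≤ S + 2 * (l.countP (fun x => x ∉ H) : ℕ) := by exact_mod_cast hmain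
  rw [← sub_nonneg]
  have : 4 * ((l.countP (fun x => x ∉ H) : ℕ) / (l.length : ℝ)) -
      (1 - S / l.length + ((∑ i ∈ G, (l.count i : ℝ)) / l.length - S / l.length)) =
      (4 * (l.countP (fun x => x ∉ H) : ℕ) - (l.length - S) -
        (∑ i ∈ G, (l.count i : ℝ) - S)) / l.length := by
    field_simp
    ring
  rw [this]
  apply div_nonneg _ hn.le
  linarith

/-- If the empirical frequencies of the buckets in `H` are close to the masses `p`, and `p` is
almost concentrated on `H`, then the learned masses are close to `p` on every set of buckets. -/
theorem sum_abs_spaPDF_sub_mass_le {k : ℕ} {l : List ℤ} {H : Finset ℤ} (hl : l ≠ [])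
    (hH : 2 * H.card ≤ k / 2) {p : ℤ → ℝ} (hp : ∀ i, 0 ≤ p i)
    (hp1 : ∀ G : Finset ℤ, ∑ i ∈ G, p i ≤ 1) {η D : ℝ} (hη : 1 - η ≤ ∑ i ∈ H, p i)
    (hD : ∑ i ∈ H, |(l.count i : ℝ) / l.length - p i| ≤ D) (hηD : η + D < 1 / 2)
    {G : Finset ℤ} (hG : (MMG.run k l).tracked ⊆ G) (hHG : H ⊆ G) :
    ∑ i ∈ G, |spaPDF (MMG.run k l) i - p i| ≤ 6 * (η + D) := by
  have hn : (0 : ℝ) < l.length := by exact_mod_cast List.length_pos_iff.2 hl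
  have htail : (l.countP (fun x => x ∉ H) : ℝ) / l.length ≤ η + D := by
    have h1 : (l.countP (fun x => x ∉ H) : ℝ) / l.length =
        1 - ∑ i ∈ H, (l.count i : ℝ) / l.length := by
      rw [← Finset.sum_div, eq_sub_iff_add_eq, ← add_div, div_eq_one_iff_eq hn.ne', add_comm]
      exact_mod_cast sum_count_add_countP_notMem l H
    have h2 : ∑ i ∈ H, (p i - (l.count i : ℝ) / l.length) ≤ D :=
      (Finset.sum_le_sum fun i _ => by rw [abs_sub_comm]; exact le_abs_self _).trans hD
    rw [Finset.sum_sub_distrib] at h2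
    linarith
  have hS : 2 * l.countP (fun x => x ∉ H) < l.length := by
    have h : (l.countP (fun x => x ∉ H) : ℝ) / l.length < 1 / 2 := htail.trans_lt hηD
    rw [div_lt_iff₀ hn] at h
    have : (2 * l.countP (fun x => x ∉ H) : ℝ) < l.length := by linarith
    exact_mod_cast this
  have h1 := sum_abs_spaPDF_sub_le hl hH hS hG
  have h2 : ∑ i ∈ G, |(l.count i : ℝ) / l.length - p i| ≤ 2 * (η + D) := by
    rw [← Finset.sum_sdiff hHG]
    have h3 : ∑ i ∈ G \ H, |(l.count i : ℝ) / l.length - p i| ≤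
        ∑ i ∈ G \ H, (l.count i : ℝ) / l.length + ∑ i ∈ G \ H, p i := by
      rw [← Finset.sum_add_distrib]
      refine Finset.sum_le_sum fun i _ => (abs_sub _ _).trans_eq ?_
      rw [abs_of_nonneg (by positivity), abs_of_nonneg (hp i)]
    have h4 : ∑ i ∈ G \ H, p i ≤ η := by
      have := hp1 G
      rw [← Finset.sum_sdiff hHG] at this
      linarith
    have h5 : ∑ i ∈ G \ H, (l.count i : ℝ) / l.length ≤
        (l.countP (fun x => x ∉ H) : ℝ) / l.length := by
      rw [← Finset.sum_div]
      gcongr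
      have e1 := sum_count_add_countP_notMem l G
      have e2 := sum_count_add_countP_notMem l H
      rw [← Finset.sum_sdiff hHG] at e1
      have : ∑ i ∈ G \ H, l.count i ≤ l.countP (fun x => x ∉ H) := by omega
      exact_mod_cast this
    linarith
  calc ∑ i ∈ G, |spaPDF (MMG.run k l) i - p i|
      ≤ ∑ i ∈ G, (|spaPDF (MMG.run k l) i - l.count i / l.length| +
          |(l.count i : ℝ) / l.length - p i|) :=
        Finset.sum_le_sum fun i _ => abs_sub_le _ _ _
    _ ≤ 6 * (η + D) := by
        rw [Finset.sum_add_distrib]; linarith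

/-! ### Concentration of functions with bounded differences -/

section BoundedDifferences

open scoped NNReal

/-- The induction step for the bounded differences inequality: Hoeffding's lemma in the first
variable, conditionally on the second. -/
theorem hasSubgaussianMGF_prod_of_boundedDifferences {A B : Type*} [MeasurableSpace A]
    [MeasurableSpace B] {μ : Measure A} {ν : Measure B} [IsProbabilityMeasure μ]
    [IsProbabilityMeasure ν] {F : A × B → ℝ} (hF : Measurable F) {M : ℝ} (hM : ∀ z, |F z| ≤ M)
    {c C : ℝ≥0} (hc : ∀ a a' b, |F (a, b) - F (a', b)| ≤ c)
    (hC : HasSubgaussianMGF (fun b => ∫ a, F (a, b) ∂μ - ∫ b, ∫ a, F (a, b) ∂μ ∂ν) C ν) :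
    HasSubgaussianMGF (fun z => F z - ∫ z, F z ∂(μ.prod ν)) (c ^ 2 + C) (μ.prod ν) := by
  have hint : Integrable F (μ.prod ν) :=
    Integrable.of_bound hF.aestronglyMeasurable M (ae_of_all _ hM)
  have hexp : ∀ t : ℝ, Integrable
      (fun z => Real.exp (t * (F z - ∫ z, F z ∂(μ.prod ν)))) (μ.prod ν) := by
    intro t
    refine Integrable.of_bound (by fun_prop)
      (Real.exp (|t| * (M + |∫ z, F z ∂(μ.prod ν)|))) (ae_of_all _ fun z => ?_)
    rw [Real.norm_eq_abs, Real.abs_exp]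
    refine Real.exp_le_exp.2 ((le_abs_self _).trans ?_)
    rw [abs_mul]
    gcongr
    exact (abs_sub _ _).trans (by gcongr; exact hM z)
  refine ⟨hexp, fun t => ?_⟩
  obtain ⟨a₀⟩ : Nonempty A := nonempty_of_isProbabilityMeasure μ
  have hinner : ∀ b, ∫ a, Real.exp (t * (F (a, b) - ∫ a, F (a, b) ∂μ)) ∂μ ≤
      Real.exp ((c : ℝ) ^ 2 * t ^ 2 / 2) := by
    intro b
    have h := (hasSubgaussianMGF_of_mem_Icc (μ := μ) (X := fun a => F (a, b))
      (a := F (a₀, b) - c) (b := F (a₀, b) + c) (by fun_prop) (ae_of_all _ fun a => by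
        have := abs_le.1 (hc a a₀ b)
        constructor <;> linarith)).mgf_le t
    have e : ((‖F (a₀, b) + c - (F (a₀, b) - c)‖₊ / 2) ^ 2 : ℝ≥0) = c ^ 2 := by
      have : F (a₀, b) + c - (F (a₀, b) - c) = ((2 * c : ℝ≥0) : ℝ) := by push_cast; ring
      rw [this, NNReal.nnnorm_eq]
      congr 1
      field_simp
    rw [e] at h
    simpa [mgf] using h
  rw [mgf, integral_prod_symm _ (hexp t), integral_prod_symm _ hint]
  have hsplit : ∀ b, ∫ a, Real.exp (t * (F (a, b) - ∫ b, ∫ a, F (a, b) ∂μ ∂ν)) ∂μ ≤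
      Real.exp ((c : ℝ) ^ 2 * t ^ 2 / 2) *
        Real.exp (t * (∫ a, F (a, b) ∂μ - ∫ b, ∫ a, F (a, b) ∂μ ∂ν)) := by
    intro b
    refine le_trans (le_of_eq ?_) (mul_le_mul_of_nonneg_right (hinner b) (Real.exp_pos _).le)
    rw [← integral_mul_const]
    congr 1 with a
    rw [← Real.exp_add]
    ring_nf
  calc _ ≤ ∫ b, Real.exp ((c : ℝ) ^ 2 * t ^ 2 / 2) *
        Real.exp (t * (∫ a, F (a, b) ∂μ - ∫ b, ∫ a, F (a, b) ∂μ ∂ν)) ∂ν := by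
        refine integral_mono_of_nonneg (ae_of_all _ fun b => ?_)
          ((hC.integrable_exp_mul t).const_mul _) (ae_of_all _ hsplit)
        exact integral_nonneg fun a => (Real.exp_pos _).le
    _ ≤ Real.exp ((c : ℝ) ^ 2 * t ^ 2 / 2) * Real.exp (C * t ^ 2 / 2) := by
        rw [integral_const_mul]
        gcongr
        exact hC.mgf_le t
    _ = _ := by
        rw [← Real.exp_add]
        push_cast
        ring_nf

/-- **McDiarmid's inequality**, in sub-Gaussian form and without the optimal constant: a bounded
function of `n` independent variables that changes by at most `c` when one variable changes is
sub-Gaussian about its mean, with parameter `n c²`. -/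
theorem hasSubgaussianMGF_pi_of_boundedDifferences {E : Type*} [MeasurableSpace E]
    (ρ : Measure E) [IsProbabilityMeasure ρ] (c : ℝ≥0) (n : ℕ) (f : (Fin n → E) → ℝ)
    (hf : Measurable f) {M : ℝ} (hM : ∀ x, |f x| ≤ M)
    (hc : ∀ x j y, |f (Function.update x j y) - f x| ≤ c) :
    HasSubgaussianMGF (fun x => f x - ∫ x, f x ∂Measure.pi fun _ => ρ) (n * c ^ 2)
      (Measure.pi fun _ => ρ) := by
  induction n with
  | zero =>
    have h : (fun x => f x - ∫ x, f x ∂Measure.pi fun _ : Fin 0 => ρ) = fun _ => 0 := by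
      ext x
      have : ∀ y, f y = f x := fun y => by rw [Subsingleton.elim y x]
      simp [this]
    rw [h]
    simp [HasSubgaussianMGF.fun_zero]
  | succ n ih =>
    have hmp := measurePreserving_piFinSuccAbove (fun _ : Fin (n + 1) => ρ) 0
    obtain ⟨e, he⟩ : ∃ e, e = MeasurableEquiv.piFinSuccAbove (fun _ : Fin (n + 1) => E) 0 :=
      ⟨_, rfl⟩
    rw [← he] at hmp
    have hsymm : ∀ a b, e.symm (a, b) = Fin.cons a b := by
      intro a b
      simp [he, MeasurableEquiv.piFinSuccAbove, Fin.insertNthEquiv]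
    have hFm : Measurable fun z => f (e.symm z) := hf.comp e.symm.measurable
    have hcomp : ∀ x, f x = f (e.symm (e x)) := fun x => by simp
    have hintF : ∫ x, f x ∂(Measure.pi fun _ => ρ) =
        ∫ z, f (e.symm z) ∂(ρ.prod (Measure.pi fun _ => ρ)) := by
      rw [← hmp.map_eq, integral_map_equiv]
      simp
    have hstep : HasSubgaussianMGF (fun z => f (e.symm z) -
        ∫ z, f (e.symm z) ∂(ρ.prod (Measure.pi fun _ : Fin n => ρ))) (c ^ 2 + n * c ^ 2)
        (ρ.prod (Measure.pi fun _ : Fin n => ρ)) := by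
      have hmeas : Measurable fun y => ∫ a, f (e.symm (a, y)) ∂ρ :=
        (hFm.stronglyMeasurable.integral_prod_left' (μ := ρ)).measurable
      refine hasSubgaussianMGF_prod_of_boundedDifferences hFm (fun z => hM _) ?_ ?_
      · intro a a' y
        have := hc (Fin.cons a' y) 0 a
        rwa [Fin.update_cons_zero, ← hsymm, ← hsymm] at this
      · refine ih _ hmeas ?_ ?_
        · intro y
          have := norm_integral_le_of_norm_le_const (μ := ρ) (f := fun a => f (e.symm (a, y)))
            (ae_of_all _ fun a => hM _)
          simpa using this
        · intro y j b
          have hi : ∀ y, Integrable (fun a => f (e.symm (a, y))) ρ := fun y =>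
            Integrable.of_bound (hFm.comp measurable_prodMk_right).aestronglyMeasurable M
              (ae_of_all _ fun a => hM _)
          rw [← integral_sub (hi _) (hi _)]
          have := norm_integral_le_of_norm_le_const (μ := ρ) (C := c)
            (f := fun a => f (e.symm (a, Function.update y j b)) - f (e.symm (a, y)))
            (ae_of_all _ fun a => by
              rw [hsymm, hsymm, Fin.cons_update]
              exact hc _ _ _)
          simpa using this
    rw [← hmp.map_eq] at hstep
    have h := HasSubgaussianMGF.of_map (hmp.measurable.aemeasurable) hstep
    rw [hmp.map_eq] at h
    rw [hintF]
    convert h using 1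
    · ext x; simp
    · push_cast; ring

end BoundedDifferences

/-! ### Empirical frequencies of an i.i.d. sample -/

theorem count_ofFn_eq_sum {α : Type*} [DecidableEq α] {n : ℕ} (y : Fin n → α) (i : α) :
    (List.ofFn y).count i = ∑ j, if y j = i then 1 else 0 := by
  induction n with
  | zero => simp
  | succ n ih =>
    rw [List.ofFn_succ, List.count_cons, ih, Fin.sum_univ_succ, add_comm]
    simp

/-- The `ℓ¹` distance on `H` between the empirical frequencies of the sample `y` and the
probabilities of single points under `ρ`. -/
noncomputable def empiricalDeviation (ρ : Measure ℤ) (H : Finset ℤ) {n : ℕ} (y : Fin n → ℤ) : ℝ :=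
  ∑ i ∈ H, |((List.ofFn y).count i : ℝ) / n - ρ.real {i}|

theorem integral_abs_frequency_sub_le (ρ : Measure ℤ) [IsProbabilityMeasure ρ] {n : ℕ}
    (hn : 0 < n) (i : ℤ) :
    ∫ y, |((List.ofFn y).count i : ℝ) / n - ρ.real {i}| ∂(Measure.pi fun _ : Fin n => ρ) ≤
      √(ρ.real {i} / n) := by
  have hn' : (0 : ℝ) < n := by exact_mod_cast hn
  obtain ⟨P, hP⟩ : ∃ P, P = Measure.pi fun _ : Fin n => ρ := ⟨_, rfl⟩
  have : IsProbabilityMeasure P := by rw [hP]; infer_instance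
  have hLp : ∀ {g : (Fin n → ℤ) → ℝ} (M : ℝ), (∀ y, |g y| ≤ M) → MemLp g 2 P := fun M hg =>
    MemLp.of_bound (Measurable.of_discrete).aestronglyMeasurable M (ae_of_all _ hg)
  let I : Fin n → (Fin n → ℤ) → ℝ := fun j y => if y j = i then 1 else 0
  have hI01 : ∀ j y, |I j y| ≤ 1 := by
    intro j y; simp only [I]; split_ifs <;> simp
  have hILp : ∀ j, MemLp (I j) 2 P := fun j => hLp 1 (hI01 j)
  have hev : ∀ j, MeasurePreserving (Function.eval j) P ρ := by
    intro j; rw [hP]; exact measurePreserving_eval (fun _ : Fin n => ρ) j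
  have hmean : ∀ j, ∫ y, I j y ∂P = ρ.real {i} := by
    intro j
    have h1 : I j = Set.indicator (Function.eval j ⁻¹' ({i} : Set ℤ)) 1 := by
      ext y; simp [I, Set.indicator]
    rw [h1, integral_indicator_one (MeasurableSet.of_discrete), measureReal_def,
      (hev j).measure_preimage (MeasurableSet.of_discrete).nullMeasurableSet, measureReal_def]
  have hind : iIndepFun I P := by
    have h := iIndepFun_pi (μ := fun _ : Fin n => ρ) (X := fun _ (a : ℤ) =>
      if a = i then (1 : ℝ) else 0) (fun _ => (Measurable.of_discrete).aemeasurable)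
    rw [hP]; exact h
  have hvar : variance (∑ j, I j) P ≤ n * ρ.real {i} := by
    rw [IndepFun.variance_sum (fun j _ => hILp j)
      (fun j _ j' _ hjj => hind.indepFun hjj)]
    calc ∑ j, variance (I j) P ≤ ∑ j : Fin n, ρ.real {i} := by
          refine Finset.sum_le_sum fun j _ => ?_
          refine (variance_le_expectation_sq (hILp j).aestronglyMeasurable).trans_eq ?_
          rw [← hmean j]
          congr 1 with y
          simp [I]
      _ = n * ρ.real {i} := by simp
  have hmeanS : ∫ y, (∑ j, I j) y ∂P = n * ρ.real {i} := by
    simp only [Finset.sum_apply]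
    rw [integral_finsetSum _ fun j _ => (hILp j).integrable (by norm_num)]
    simp [hmean]
  have hZ : ∀ y, ((List.ofFn y).count i : ℝ) / n - ρ.real {i} =
      ((∑ j, I j) y - ∫ y, (∑ j, I j) y ∂P) / n := by
    intro y
    rw [hmeanS, count_ofFn_eq_sum, Finset.sum_apply]
    push_cast
    field_simp
    simp [I]
  have hSLp : MemLp (∑ j, I j) 2 P := memLp_finsetSum' _ fun j _ => hILp j
  have hWLp : MemLp (fun y => |(∑ j, I j) y - ∫ y, (∑ j, I j) y ∂P|) 2 P :=
    (hSLp.sub (memLp_const _)).abs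
  have hsq : (∫ y, |(∑ j, I j) y - ∫ y, (∑ j, I j) y ∂P| ∂P) ^ 2 ≤ variance (∑ j, I j) P := by
    have h1 := variance_nonneg (fun y => |(∑ j, I j) y - ∫ y, (∑ j, I j) y ∂P|) P
    rw [variance_eq_sub hWLp] at h1
    rw [variance_eq_integral hSLp.aestronglyMeasurable.aemeasurable]
    simp only [Pi.pow_apply, sq_abs] at h1
    linarith
  rw [← hP]
  simp_rw [hZ, abs_div, Nat.abs_cast]
  rw [integral_div]
  apply Real.le_sqrt_of_sq_le
  rw [div_pow, div_le_div_iff₀ (by positivity) hn']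
  nlinarith [hsq.trans hvar]

/-- With high probability the empirical frequencies are close in `ℓ¹` to the probabilities. -/
theorem measure_empiricalDeviation_ge_le (ρ : Measure ℤ) [IsProbabilityMeasure ρ] {n : ℕ}
    (hn : 0 < n) (H : Finset ℤ) {V t : ℝ} (hV : ∑ i ∈ H, √(ρ.real {i}) ≤ V * √n) (ht : 0 ≤ t) :
    (Measure.pi fun _ : Fin n => ρ).real {y | V + t ≤ empiricalDeviation ρ H y} ≤
      Real.exp (-(n * t ^ 2 / 8)) := by
  have hn' : (0 : ℝ) < n := by exact_mod_cast hn
  obtain ⟨P, hP⟩ : ∃ P, P = Measure.pi fun _ : Fin n => ρ := ⟨_, rfl⟩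
  have : IsProbabilityMeasure P := by rw [hP]; infer_instance
  have hterm : ∀ (y : Fin n → ℤ) i, |((List.ofFn y).count i : ℝ) / n - ρ.real {i}| ≤ 1 := by
    intro y i
    have h1 : ((List.ofFn y).count i : ℝ) / n ≤ 1 := by
      rw [div_le_one hn']
      have := List.count_le_length (a := i) (l := List.ofFn y)
      rw [List.length_ofFn] at this
      exact_mod_cast this
    have h2 : (0 : ℝ) ≤ ((List.ofFn y).count i : ℝ) / n := by positivity
    have h3 : ρ.real {i} ≤ 1 := measureReal_le_one
    have h4 : 0 ≤ ρ.real {i} := measureReal_nonneg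
    rw [abs_le]; constructor <;> linarith
  have hbound : ∀ y : Fin n → ℤ, |empiricalDeviation ρ H y| ≤ H.card := by
    intro y
    rw [abs_of_nonneg (Finset.sum_nonneg fun _ _ => abs_nonneg _)]
    refine (Finset.sum_le_sum fun i _ => hterm y i).trans_eq ?_
    simp
  have hmean : ∫ y, empiricalDeviation ρ H y ∂P ≤ V := by
    have hint : ∀ i ∈ H, Integrable
        (fun y : Fin n → ℤ => |((List.ofFn y).count i : ℝ) / n - ρ.real {i}|) P := fun i _ =>
      Integrable.of_bound (Measurable.of_discrete).aestronglyMeasurable 1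
        (ae_of_all _ fun y => by simpa using hterm y i)
    unfold empiricalDeviation
    rw [integral_finsetSum _ hint, hP]
    refine (Finset.sum_le_sum fun i _ => integral_abs_frequency_sub_le ρ hn i).trans ?_
    simp_rw [Real.sqrt_div' _ hn'.le]
    rw [← Finset.sum_div]
    exact (div_le_iff₀ (Real.sqrt_pos.2 hn')).2 hV
  have hdiff : ∀ (y : Fin n → ℤ) j a, |empiricalDeviation ρ H (Function.update y j a) -
      empiricalDeviation ρ H y| ≤ ((2 / n : NNReal) : ℝ) := by
    intro y j a
    unfold empiricalDeviation
    rw [← Finset.sum_sub_distrib]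
    refine (Finset.abs_sum_le_sum_abs _ _).trans ?_
    have hpt : ∀ i ∈ H, |(|((List.ofFn (Function.update y j a)).count i : ℝ) / n - ρ.real {i}| -
        |((List.ofFn y).count i : ℝ) / n - ρ.real {i}|)| ≤
        ((if a = i then 1 else 0) + (if y j = i then 1 else 0)) / n := by
      intro i _
      refine (abs_abs_sub_abs_le_abs_sub _ _).trans ?_
      rw [sub_sub_sub_cancel_right, ← sub_div, abs_div, Nat.abs_cast]
      gcongr
      rw [count_ofFn_eq_sum, count_ofFn_eq_sum, ← Finset.add_sum_erase _ _ (Finset.mem_univ j),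
        ← Finset.add_sum_erase _ (fun j => if y j = i then 1 else 0) (Finset.mem_univ j)]
      have : ∑ x ∈ Finset.univ.erase j, (if Function.update y j a x = i then 1 else 0) =
          ∑ x ∈ Finset.univ.erase j, if y x = i then 1 else 0 :=
        Finset.sum_congr rfl fun x hx => by
          rw [Function.update_of_ne (Finset.ne_of_mem_erase hx)]
      rw [this, Function.update_self]
      push_cast
      rw [add_sub_add_right_eq_sub]
      split_ifs <;> norm_num
    refine (Finset.sum_le_sum hpt).trans ?_
    rw [← Finset.sum_div, Finset.sum_add_distrib]
    push_cast
    gcongr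
    have h1 : ∀ b : ℤ, ∑ i ∈ H, (if b = i then (1 : ℝ) else 0) ≤ 1 := by
      intro b; rw [Finset.sum_ite_eq]; split_ifs <;> norm_num
    linarith [h1 a, h1 (y j)]
  have hsub := hasSubgaussianMGF_pi_of_boundedDifferences ρ (2 / n) n
    (empiricalDeviation ρ H) Measurable.of_discrete hbound hdiff
  rw [← hP] at hsub ⊢
  have h := hsub.measure_ge_le ht
  refine (measureReal_mono ?_ (by finiteness)).trans (h.trans_eq ?_)
  · intro y hy
    simp only [Set.mem_ofPred_eq] at hy ⊢
    linarith
  · congr 1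
    push_cast
    field_simp
    norm_num

theorem IsIIDSample.map_bucket {Ω : Type*} [MeasurableSpace Ω] {P : Measure Ω}
    [IsProbabilityMeasure P] {n : ℕ} {X : Fin n → Ω → ℝ} {μ : Measure ℝ}
    (h : IsIIDSample P X μ) {g : ℝ → ℤ} (hg : Measurable g) :
    P.map (fun ω j => g (X j ω)) = Measure.pi fun _ : Fin n => μ.map g := by
  have hX : ∀ j, AEMeasurable (X j) P := fun j => (h.law j).aemeasurable
  have hgX : ∀ j, AEMeasurable (fun ω => g (X j ω)) P := fun j => hg.comp_aemeasurable (hX j)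
  have hind : iIndepFun (fun j ω => g (X j ω)) P := h.indep.comp (fun _ => g) fun _ => hg
  rw [(iIndepFun_iff_map_fun_eq_pi_map hgX).1 hind]
  congr 1 with j : 1
  rw [← (h.law j).map_eq, AEMeasurable.map_map_of_aemeasurable hg.aemeasurable (hX j)]
  rfl

/-- With high probability the empirical bucket frequencies of an i.i.d. sample are close in `ℓ¹` to
the bucket masses. -/
theorem IsIIDSample.measure_empiricalDeviation_ge_le {Ω : Type*} [MeasurableSpace Ω]
    {P : Measure Ω} [IsProbabilityMeasure P] {n : ℕ} {X : Fin n → Ω → ℝ} {μ : Measure ℝ}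
    [IsProbabilityMeasure μ] (h : IsIIDSample P X μ) (hn : 0 < n) {g : ℝ → ℤ} (hg : Measurable g)
    (H : Finset ℤ) {V t : ℝ} (hV : ∑ i ∈ H, √((μ.map g).real {i}) ≤ V * √n) (ht : 0 ≤ t) :
    P.real {ω | V + t ≤ empiricalDeviation (μ.map g) H fun j => g (X j ω)} ≤
      Real.exp (-(n * t ^ 2 / 8)) := by
  have : IsProbabilityMeasure (μ.map g) := Measure.isProbabilityMeasure_map hg.aemeasurable
  refine le_trans (le_of_eq ?_) (_root_.measure_empiricalDeviation_ge_le (μ.map g) hn H hV ht)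
  rw [← h.map_bucket hg, map_measureReal_apply_of_aemeasurable _ MeasurableSet.of_discrete]
  · rfl
  · exact aemeasurable_pi_lambda _ fun j => hg.comp_aemeasurable (h.law j).aemeasurable

/-! ### Lipschitz densities -/

section LipschitzDensity

variable {p q : ℝ → ℝ} {μ ν : Measure ℝ} {ℓ : ℝ}

theorem continuous_of_abs_sub_le (hp : ∀ x y, |p x - p y| ≤ ℓ * |x - y|) : Continuous p := by
  have h : LipschitzWith (Real.toNNReal ℓ) p := LipschitzWith.of_dist_le_mul fun x y => by
    rw [Real.dist_eq, Real.dist_eq]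
    exact (hp x y).trans (mul_le_mul_of_nonneg_right (Real.le_coe_toNNReal _) (abs_nonneg _))
  exact h.continuous

theorem integrable_of_withDensity [IsProbabilityMeasure μ] (hc : Continuous p)
    (h0 : ∀ x, 0 ≤ p x) (hμ : μ = volume.withDensity fun x => ENNReal.ofReal (p x)) :
    Integrable p := by
  refine ⟨hc.aestronglyMeasurable, ?_⟩
  rw [hasFiniteIntegral_iff_ofReal (ae_of_all _ h0)]
  have : μ Set.univ = ∫⁻ x, ENNReal.ofReal (p x) := by
    rw [hμ, withDensity_apply _ MeasurableSet.univ, setLIntegral_univ]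
  rw [← this]
  exact measure_lt_top _ _

theorem measureReal_eq_setIntegral (hc : Continuous p) (h0 : ∀ x, 0 ≤ p x)
    (hμ : μ = volume.withDensity fun x => ENNReal.ofReal (p x)) {A : Set ℝ}
    (hA : MeasurableSet A) : μ.real A = ∫ x in A, p x := by
  rw [measureReal_def, hμ, withDensity_apply _ hA,
    integral_eq_lintegral_of_nonneg_ae (ae_of_all _ h0) hc.aestronglyMeasurable]

/-- An `ℓ`-Lipschitz probability density is at most `√ℓ`, since a triangle of height `h` and slopes
`±ℓ` below its graph has area `h² / ℓ`. -/
theorem lipschitz_density_le_sqrt [IsProbabilityMeasure μ] (hℓ : 0 < ℓ)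
    (h0 : ∀ x, 0 ≤ p x) (hp : ∀ x y, |p x - p y| ≤ ℓ * |x - y|)
    (hμ : μ = volume.withDensity fun x => ENNReal.ofReal (p x)) (x : ℝ) : p x ≤ √ℓ := by
  have hc := continuous_of_abs_sub_le hp
  have hi := integrable_of_withDensity hc h0 hμ
  obtain ⟨r, hr⟩ : ∃ r, r = p x / ℓ := ⟨_, rfl⟩
  have hr0 : 0 ≤ r := by rw [hr]; exact div_nonneg (h0 x) hℓ.le
  have hpx : p x = ℓ * r := by rw [hr]; field_simp
  have h1 : ∫ y in x..x + r, (p x - ℓ * (y - x)) ≤ ∫ y in x..x + r, p y := by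
    refine intervalIntegral.integral_mono_on (by linarith)
      (Continuous.intervalIntegrable (by fun_prop) _ _) (hc.intervalIntegrable _ _) ?_
    intro y hy
    have := (abs_le.1 (hp x y)).2
    rw [abs_of_nonpos (by linarith [hy.1])] at this
    linarith
  have h2 : ∫ y in x - r..x, (p x - ℓ * (x - y)) ≤ ∫ y in x - r..x, p y := by
    refine intervalIntegral.integral_mono_on (by linarith)
      (Continuous.intervalIntegrable (by fun_prop) _ _) (hc.intervalIntegrable _ _) ?_
    intro y hy
    have := (abs_le.1 (hp x y)).2
    rw [abs_of_nonneg (by linarith [hy.2])] at this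
    linarith
  have h3 : ∫ y in x..x + r, (p x - ℓ * (y - x)) = ℓ * r ^ 2 / 2 := by
    have e : ∀ y, p x - ℓ * (y - x) = (p x + ℓ * x) - ℓ * y := fun y => by ring
    simp_rw [e]
    rw [intervalIntegral.integral_sub (by simp)
      (Continuous.intervalIntegrable (by fun_prop) _ _),
      intervalIntegral.integral_const_mul, integral_id, intervalIntegral.integral_const, hpx]
    simp only [smul_eq_mul]
    ring
  have h4 : ∫ y in x - r..x, (p x - ℓ * (x - y)) = ℓ * r ^ 2 / 2 := by
    have e : ∀ y, p x - ℓ * (x - y) = (p x - ℓ * x) + ℓ * y := fun y => by ring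
    simp_rw [e]
    rw [intervalIntegral.integral_add (by simp)
      (Continuous.intervalIntegrable (by fun_prop) _ _),
      intervalIntegral.integral_const_mul, integral_id, intervalIntegral.integral_const, hpx]
    simp only [smul_eq_mul]
    ring
  have h5 : (∫ y in x - r..x, p y) + ∫ y in x..x + r, p y ≤ 1 := by
    rw [intervalIntegral.integral_add_adjacent_intervals (hc.intervalIntegrable _ _)
      (hc.intervalIntegrable _ _), intervalIntegral.integral_of_le (by linarith),
      ← measureReal_eq_setIntegral hc h0 hμ measurableSet_Ioc]
    exact measureReal_le_one
  apply Real.le_sqrt_of_sq_le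
  have h6 : ℓ * r ^ 2 ≤ 1 := by linarith
  rw [hpx]
  nlinarith

/-- A distribution with an `ℓ`-Lipschitz density that has most of its mass in an interval of radius
`R` satisfies `ε ≤ ℓ R²`. -/
theorem HasLipschitzPDF.le_mul_sq [IsProbabilityMeasure μ] (h : HasLipschitzPDF μ ℓ) (hℓ : 0 < ℓ)
    {a R ε : ℝ} (hR : 0 < R) (hε : ε ≤ 1 / 6) (htail : μ.real {x | R ≤ |x - a|} ≤ ε) :
    ε ≤ ℓ * R ^ 2 := by
  obtain ⟨p, h0, hp, hμ⟩ := h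
  have hc := continuous_of_abs_sub_le hp
  have hset : {x | R ≤ |x - a|} = (Set.Ioo (a - R) (a + R))ᶜ := by
    ext x
    simp only [Set.mem_ofPred_eq, Set.mem_compl_iff, Set.mem_Ioo, ← not_lt, abs_lt]
    rw [not_iff_not]
    constructor <;> rintro ⟨h1, h2⟩ <;> constructor <;> linarith
  rw [hset, probReal_compl_eq_one_sub measurableSet_Ioo,
    measureReal_eq_setIntegral hc h0 hμ measurableSet_Ioo] at htail
  have h1 : ∫ x in Set.Ioo (a - R) (a + R), p x ≤ √ℓ * (2 * R) := by
    have := norm_setIntegral_le_of_norm_le_const (μ := volume) (f := p)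
      (s := Set.Ioo (a - R) (a + R)) (C := √ℓ) (by simp)
      (fun x _ => by
        rw [Real.norm_of_nonneg (h0 x)]
        exact lipschitz_density_le_sqrt hℓ h0 hp hμ x)
    refine (le_abs_self _).trans (this.trans_eq ?_)
    rw [Real.volume_real_Ioo_of_le (by linarith)]
    ring
  -- Squaring gives `25 / 144 ≤ ℓ R²`, and `1 / 6 < 25 / 144`.
  have h2 : 5 / 6 ≤ √ℓ * (2 * R) := by linarith
  have h3 : (5 / 6) ^ 2 ≤ (√ℓ * (2 * R)) ^ 2 := by gcongr
  rw [mul_pow, Real.sq_sqrt hℓ.le] at h3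
  nlinarith

theorem HasLipschitzPDF.mono {ℓ' : ℝ} (h : HasLipschitzPDF μ ℓ) (hℓ : ℓ ≤ ℓ') :
    HasLipschitzPDF μ ℓ' := by
  obtain ⟨p, h0, hp, hμ⟩ := h
  exact ⟨p, h0, fun x y => (hp x y).trans (by gcongr), hμ⟩

/-- On an interval of length `b`, either the difference `f` of the two densities has a constant sign,
or `|f| ≤ 2 ℓ b` throughout. In the second case the integrals `u` and `v` of `f` over the two parts
into which `A` splits the interval satisfy `u - v ≤ 2 ℓ b²`, so that `u` exceeds half the integral
`u + v` over the interval by at most `ℓ b²`. -/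
theorem HasLipschitzPDF.measureReal_inter_Ico_sub_le [IsProbabilityMeasure μ]
    [IsProbabilityMeasure ν] (hμ : HasLipschitzPDF μ ℓ) (hν : HasLipschitzPDF ν ℓ) (hℓ : 0 < ℓ)
    {u b : ℝ} (hb : 0 < b) {A : Set ℝ} (hA : MeasurableSet A) :
    μ.real (A ∩ Set.Ico u (u + b)) - ν.real (A ∩ Set.Ico u (u + b)) ≤
      max (μ.real (Set.Ico u (u + b)) - ν.real (Set.Ico u (u + b))) 0 + ℓ * b ^ 2 := by
  obtain ⟨p, hp0, hp, hμ⟩ := hμ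
  obtain ⟨q, hq0, hq, hν⟩ := hν
  have hpc := continuous_of_abs_sub_le hp
  have hqc := continuous_of_abs_sub_le hq
  have hpi := integrable_of_withDensity hpc hp0 hμ
  have hqi := integrable_of_withDensity hqc hq0 hν
  have hd : ∀ {B : Set ℝ}, MeasurableSet B → μ.real B - ν.real B = ∫ x in B, (p x - q x) := by
    intro B hB
    rw [measureReal_eq_setIntegral hpc hp0 hμ hB, measureReal_eq_setIntegral hqc hq0 hν hB,
      integral_sub hpi.integrableOn hqi.integrableOn]
  have hAI : MeasurableSet (A ∩ Set.Ico u (u + b)) := hA.inter measurableSet_Ico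
  rw [hd hAI, hd measurableSet_Ico]
  have hpos : 0 ≤ ℓ * b ^ 2 := by positivity
  by_cases h1 : ∀ x ∈ Set.Ico u (u + b), p x ≤ q x
  · have : ∫ x in A ∩ Set.Ico u (u + b), (p x - q x) ≤ 0 :=
      setIntegral_nonpos hAI fun x hx => by linarith [h1 x hx.2]
    exact this.trans (add_nonneg (le_max_right _ _) hpos)
  by_cases h2 : ∀ x ∈ Set.Ico u (u + b), q x ≤ p x
  · have : ∫ x in A ∩ Set.Ico u (u + b), (p x - q x) ≤ ∫ x in Set.Ico u (u + b), (p x - q x) := by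
      refine setIntegral_mono_set (hpi.sub hqi).integrableOn ?_
        Set.inter_subset_right.eventuallyLE
      filter_upwards [ae_restrict_mem measurableSet_Ico] with x hx
      simpa using h2 x hx
    linarith [le_max_left (∫ x in Set.Ico u (u + b), (p x - q x)) 0]
  · push Not at h1 h2
    obtain ⟨x, hx, hqx⟩ := h1
    obtain ⟨y, hy, hpy⟩ := h2
    obtain ⟨z, hz, hpq⟩ := isPreconnected_Ico.intermediate_value₂ hx hy hqc.continuousOn
      hpc.continuousOn hqx.le hpy.le
    have h3 : ∀ x ∈ Set.Ico u (u + b), ‖p x - q x‖ ≤ 2 * ℓ * b := by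
      intro x hx
      have e : p x - q x = (p x - p z) - (q x - q z) := by rw [hpq]; ring
      have hxz : |x - z| ≤ b := by
        rw [abs_le]; constructor <;> linarith [hx.1, hx.2, hz.1, hz.2]
      have hxz' := mul_le_mul_of_nonneg_left hxz hℓ.le
      rw [Real.norm_eq_abs, e]
      refine (abs_sub _ _).trans ?_
      linarith [hp x z, hq x z]
    have h4 : ∀ {B : Set ℝ}, B ⊆ Set.Ico u (u + b) →
        |∫ x in B, (p x - q x)| ≤ 2 * ℓ * b * volume.real B := fun hB =>
      norm_setIntegral_le_of_norm_le_const ((measure_mono hB).trans_lt (by simp))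
        fun x hx => h3 x (hB hx)
    have h5 := (le_abs_self _).trans (h4 (Set.inter_subset_right (s := A)))
    have h6 := (neg_le_abs _).trans (h4 (Set.sdiff_subset (s := Set.Ico u (u + b)) (t := A)))
    have h7 := integral_inter_add_sdiff (μ := volume) (s := Set.Ico u (u + b)) hA
      (hpi.sub hqi).integrableOn
    have h8 := measureReal_inter_add_sdiff (μ := volume) (s := Set.Ico u (u + b)) (t := A) hA
      (by simp)
    rw [Real.volume_real_Ico_of_le (by linarith), Set.inter_comm] at h8
    rw [Set.inter_comm] at h7
    simp only [Pi.sub_apply] at h7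
    have h9 : 2 * ℓ * b * volume.real (A ∩ Set.Ico u (u + b)) +
        2 * ℓ * b * volume.real (Set.Ico u (u + b) \ A) = 2 * ℓ * b ^ 2 := by
      rw [← mul_add, h8]; ring
    have h10 := le_max_left (∫ x in Set.Ico u (u + b), (p x - q x)) 0
    have h11 := le_max_right (∫ x in Set.Ico u (u + b), (p x - q x)) 0
    linarith

end LipschitzDensity

/-! ### Total variation distance and bucket masses -/

theorem measurable_bucket (b x₀ : ℝ) : Measurable (bucket b x₀) := by
  unfold bucket
  exact Int.measurable_floor.comp (by fun_prop)

theorem bucket_preimage_singleton {b : ℝ} (hb : 0 < b) (x₀ : ℝ) (i : ℤ) :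
    bucket b x₀ ⁻¹' {i} = Set.Ico (x₀ + i * b) (x₀ + i * b + b) := by
  ext x
  simp only [Set.mem_preimage, Set.mem_singleton_iff, bucket, Int.floor_eq_iff, Set.mem_Ico,
    le_div_iff₀ hb, div_lt_iff₀ hb]
  constructor <;> rintro ⟨h1, h2⟩ <;> constructor <;> linarith

theorem bucket_mono {b : ℝ} (hb : 0 < b) (x₀ : ℝ) : Monotone (bucket b x₀) := by
  intro x y hxy
  unfold bucket
  gcongr

/-- The mass of bucket `i` under `μ`. -/
noncomputable def bucketMass (b x₀ : ℝ) (μ : Measure ℝ) (i : ℤ) : ℝ :=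
  (μ.map (bucket b x₀)).real {i}

theorem bucketMass_nonneg (b x₀ : ℝ) (μ : Measure ℝ) (i : ℤ) : 0 ≤ bucketMass b x₀ μ i :=
  measureReal_nonneg

theorem bucketMass_eq (b x₀ : ℝ) (μ : Measure ℝ) (i : ℤ) :
    bucketMass b x₀ μ i = μ.real (bucket b x₀ ⁻¹' {i}) :=
  map_measureReal_apply (measurable_bucket b x₀) (measurableSet_singleton i)

theorem sum_measureReal_inter_bucket (b x₀ : ℝ) (μ : Measure ℝ) [IsProbabilityMeasure μ]
    {A : Set ℝ} (hA : MeasurableSet A) (G : Finset ℤ) :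
    ∑ i ∈ G, μ.real (A ∩ bucket b x₀ ⁻¹' {i}) = μ.real (A ∩ bucket b x₀ ⁻¹' (G : Set ℤ)) := by
  have : A ∩ bucket b x₀ ⁻¹' (G : Set ℤ) = ⋃ i ∈ G, A ∩ bucket b x₀ ⁻¹' {i} := by
    ext x; simp
  rw [this, measureReal_biUnion_finset]
  · intro i _ j _ hij
    refine Set.disjoint_left.2 fun x hx hx' => hij ?_
    rw [← show bucket b x₀ x = i from hx.2, ← show bucket b x₀ x = j from hx'.2]
  · exact fun i _ => hA.inter (measurable_bucket b x₀ (measurableSet_singleton i))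

theorem sum_bucketMass_eq (b x₀ : ℝ) (μ : Measure ℝ) [IsProbabilityMeasure μ] (G : Finset ℤ) :
    ∑ i ∈ G, bucketMass b x₀ μ i = μ.real (bucket b x₀ ⁻¹' (G : Set ℤ)) := by
  have := sum_measureReal_inter_bucket b x₀ μ MeasurableSet.univ G
  simpa [bucketMass_eq] using this

theorem sum_bucketMass_le_one (b x₀ : ℝ) (μ : Measure ℝ) [IsProbabilityMeasure μ]
    (G : Finset ℤ) : ∑ i ∈ G, bucketMass b x₀ μ i ≤ 1 := by
  rw [sum_bucketMass_eq]; exact measureReal_le_one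

theorem measureReal_bucket_notMem (b x₀ : ℝ) (μ : Measure ℝ) [IsProbabilityMeasure μ]
    (G : Finset ℤ) : μ.real {x | bucket b x₀ x ∉ G} = 1 - ∑ i ∈ G, bucketMass b x₀ μ i := by
  rw [sum_bucketMass_eq, ← probReal_compl_eq_one_sub
    (measurable_bucket b x₀ (MeasurableSet.of_discrete))]
  rfl

theorem abs_sub_le_tvDist (μ ν : Measure ℝ) [IsProbabilityMeasure μ] [IsProbabilityMeasure ν]
    {A : Set ℝ} (hA : MeasurableSet A) : |μ.real A - ν.real A| ≤ tvDist μ ν := by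
  refine le_ciSup (f := fun A : {A : Set ℝ // MeasurableSet A} => |μ.real A - ν.real A|)
    ⟨1, ?_⟩ ⟨A, hA⟩
  rintro _ ⟨B, rfl⟩
  have h1 : μ.real B ≤ 1 := measureReal_le_one
  have h2 : ν.real B ≤ 1 := measureReal_le_one
  have h3 : 0 ≤ μ.real B := measureReal_nonneg
  have h4 : 0 ≤ ν.real B := measureReal_nonneg
  simp only [abs_le]
  constructor <;> linarith

/-- Discretisation does not increase the total variation distance. -/
theorem half_sum_abs_bucketMass_sub_le (b x₀ : ℝ) (μ ν : Measure ℝ) [IsProbabilityMeasure μ]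
    [IsProbabilityMeasure ν] (G : Finset ℤ) :
    1 / 2 * ∑ i ∈ G, |bucketMass b x₀ μ i - bucketMass b x₀ ν i| ≤ tvDist μ ν := by
  have hpart : ∀ G' : Finset ℤ,
      |∑ i ∈ G', (bucketMass b x₀ μ i - bucketMass b x₀ ν i)| ≤ tvDist μ ν := by
    intro G'
    rw [Finset.sum_sub_distrib, sum_bucketMass_eq, sum_bucketMass_eq]
    exact abs_sub_le_tvDist μ ν (measurable_bucket b x₀ MeasurableSet.of_discrete)
  rw [← Finset.sum_filter_add_sum_filter_not G
    (fun i => 0 ≤ bucketMass b x₀ μ i - bucketMass b x₀ ν i)]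
  have h1 := (le_abs_self _).trans (hpart (G.filter
    fun i => 0 ≤ bucketMass b x₀ μ i - bucketMass b x₀ ν i))
  have h2 := (neg_le_abs _).trans (hpart (G.filter
    fun i => ¬ 0 ≤ bucketMass b x₀ μ i - bucketMass b x₀ ν i))
  rw [← Finset.sum_neg_distrib] at h2
  rw [Finset.sum_congr rfl fun i hi => abs_of_nonneg (Finset.mem_filter.1 hi).2,
    Finset.sum_congr rfl fun i hi => abs_of_neg (not_le.1 (Finset.mem_filter.1 hi).2)]
  linarith

/-- Discretisation loses at most `ℓ b²` for each bucket of `F`, and the mass that the other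
buckets have under `μ`. The last term bounds the sum of positive parts by half the sum of absolute
values. -/
theorem tvDist_le_half_sum_abs_bucketMass_sub {μ ν : Measure ℝ} [IsProbabilityMeasure μ]
    [IsProbabilityMeasure ν] {ℓ b : ℝ} (hμ : HasLipschitzPDF μ ℓ) (hν : HasLipschitzPDF ν ℓ)
    (hℓ : 0 < ℓ) (hb : 0 < b) (x₀ : ℝ) {F G : Finset ℤ} (hFG : F ⊆ G) :
    tvDist μ ν ≤ 1 / 2 * ∑ i ∈ G, |bucketMass b x₀ μ i - bucketMass b x₀ ν i| +
      F.card * (ℓ * b ^ 2) + μ.real {x | bucket b x₀ x ∉ F} +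
      1 / 2 * ν.real {x | bucket b x₀ x ∉ G} := by
  have hone : ∀ A : Set ℝ, MeasurableSet A → μ.real A - ν.real A ≤
      1 / 2 * ∑ i ∈ G, |bucketMass b x₀ μ i - bucketMass b x₀ ν i| +
      F.card * (ℓ * b ^ 2) + μ.real {x | bucket b x₀ x ∉ F} +
      1 / 2 * ν.real {x | bucket b x₀ x ∉ G} := by
    intro A hA
    have h1 : μ.real A ≤ ∑ i ∈ F, μ.real (A ∩ bucket b x₀ ⁻¹' {i}) +
        μ.real {x | bucket b x₀ x ∉ F} := by
      rw [sum_measureReal_inter_bucket b x₀ μ hA]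
      refine (measureReal_mono ?_).trans (measureReal_union_le _ _)
      intro x hx
      by_cases hxF : bucket b x₀ x ∈ F
      · exact Or.inl ⟨hx, hxF⟩
      · exact Or.inr hxF
    have h2 : ∑ i ∈ F, ν.real (A ∩ bucket b x₀ ⁻¹' {i}) ≤ ν.real A := by
      rw [sum_measureReal_inter_bucket b x₀ ν hA]
      exact measureReal_mono Set.inter_subset_left
    have h3 : ∑ i ∈ F, (μ.real (A ∩ bucket b x₀ ⁻¹' {i}) - ν.real (A ∩ bucket b x₀ ⁻¹' {i})) ≤
        ∑ i ∈ F, (max (bucketMass b x₀ μ i - bucketMass b x₀ ν i) 0 + ℓ * b ^ 2) := by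
      refine Finset.sum_le_sum fun i _ => ?_
      rw [bucketMass_eq, bucketMass_eq, bucket_preimage_singleton hb]
      exact hμ.measureReal_inter_Ico_sub_le hν hℓ hb hA
    have h4 : ∑ i ∈ F, max (bucketMass b x₀ μ i - bucketMass b x₀ ν i) 0 ≤
        ∑ i ∈ G, max (bucketMass b x₀ μ i - bucketMass b x₀ ν i) 0 :=
      Finset.sum_le_sum_of_subset_of_nonneg hFG fun _ _ _ => le_max_right _ _
    have h5 : ∀ r : ℝ, max r 0 = 1 / 2 * |r| + 1 / 2 * r := by
      intro r
      rcases le_total 0 r with hr | hr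
      · rw [max_eq_left hr, abs_of_nonneg hr]; ring
      · rw [max_eq_right hr, abs_of_nonpos hr]; ring
    simp_rw [h5] at h4
    simp_rw [h5] at h3
    have h6 := sum_bucketMass_le_one b x₀ μ G
    rw [measureReal_bucket_notMem b x₀ ν G]
    rw [Finset.sum_sub_distrib, Finset.sum_add_distrib] at h3
    simp only [Finset.sum_const, nsmul_eq_mul] at h3
    have h7 : ∑ i ∈ G, (1 / 2 * |bucketMass b x₀ μ i - bucketMass b x₀ ν i| +
        1 / 2 * (bucketMass b x₀ μ i - bucketMass b x₀ ν i)) =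
        1 / 2 * ∑ i ∈ G, |bucketMass b x₀ μ i - bucketMass b x₀ ν i| +
        1 / 2 * (∑ i ∈ G, bucketMass b x₀ μ i - ∑ i ∈ G, bucketMass b x₀ ν i) := by
      rw [Finset.sum_add_distrib, ← Finset.mul_sum, ← Finset.mul_sum, Finset.sum_sub_distrib]
    linarith
  have : Nonempty {A : Set ℝ // MeasurableSet A} := ⟨⟨∅, MeasurableSet.empty⟩⟩
  refine ciSup_le fun A => ?_
  rw [abs_le]
  have h1 := hone A A.2
  have h2 := hone (A : Set ℝ)ᶜ A.2.compl
  rw [probReal_compl_eq_one_sub A.2, probReal_compl_eq_one_sub A.2] at h2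
  constructor <;> linarith

/-- The buckets that meet the interval of radius `R` about `a`. -/
noncomputable def coreBuckets (b x₀ a R : ℝ) : Finset ℤ :=
  Finset.Icc (bucket b x₀ (a - R)) (bucket b x₀ (a + R))

theorem card_coreBuckets_le {b : ℝ} (hb : 0 < b) (x₀ a : ℝ) {R : ℝ} (hR : 0 ≤ R) :
    ((coreBuckets b x₀ a R).card : ℝ) ≤ 2 * R / b + 2 := by
  have hle : bucket b x₀ (a - R) ≤ bucket b x₀ (a + R) := bucket_mono hb x₀ (by linarith)
  have h1 : ((coreBuckets b x₀ a R).card : ℝ) =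
      (bucket b x₀ (a + R) : ℝ) + 1 - bucket b x₀ (a - R) := by
    rw [coreBuckets, Int.card_Icc]
    have : ((bucket b x₀ (a + R) + 1 - bucket b x₀ (a - R)).toNat : ℤ) =
        bucket b x₀ (a + R) + 1 - bucket b x₀ (a - R) := Int.toNat_of_nonneg (by omega)
    exact_mod_cast this
  have h2 : (bucket b x₀ (a + R) : ℝ) ≤ (a + R - x₀) / b := Int.floor_le _
  have h3 : (a - R - x₀) / b < bucket b x₀ (a - R) + 1 := Int.lt_floor_add_one _
  have h4 : (a + R - x₀) / b - (a - R - x₀) / b = 2 * R / b := by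
    rw [← sub_div]; congr 1; ring
  linarith

theorem measureReal_notMem_coreBuckets_le {b : ℝ} (hb : 0 < b) (x₀ a R : ℝ) (μ : Measure ℝ)
    [IsProbabilityMeasure μ] :
    μ.real {x | bucket b x₀ x ∉ coreBuckets b x₀ a R} ≤ μ.real {x | R ≤ |x - a|} := by
  refine measureReal_mono fun x hx => ?_
  by_contra hlt
  have hlt : ¬ R ≤ |x - a| := hlt
  refine hx (Finset.mem_Icc.2 ?_)
  have h := abs_lt.1 (not_le.1 hlt)
  exact ⟨bucket_mono hb x₀ (by linarith [h.1]), bucket_mono hb x₀ (by linarith [h.2])⟩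

/-! ### The error of the total variation estimator -/

/-- The estimator is accurate whenever the empirical bucket frequencies of both streams are. The
discretisation costs at most `(2 R / b + 2) ℓ b² ≤ 4 ε` in the core of `μ`, and `ε` outside it; the
two summaries cost `3 ε / 8` each. -/
theorem abs_stva_sub_tvDist_lt {μ ν : Measure ℝ} [IsProbabilityMeasure μ] [IsProbabilityMeasure ν]
    {ℓ ε R a x₀ : ℝ} {k n : ℕ} (hμ : HasLipschitzPDF μ ℓ) (hν : HasLipschitzPDF ν ℓ) (hℓ : 0 < ℓ)
    (hε : 0 < ε) (hε6 : ε ≤ 1 / 6) (hR : 0 < R) (ha : μ.real {x | R ≤ |x - a|} ≤ ε)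
    {b : ℝ} (hb : b = ε / (ℓ * R)) {H₁ H₂ : Finset ℤ} (hk₁ : 4 * H₁.card ≤ k)
    (hk₂ : 4 * H₂.card ≤ k) (hH₁ : 1 - ε / 16 ≤ ∑ i ∈ H₁, bucketMass b x₀ μ i)
    (hH₂ : 1 - ε / 16 ≤ ∑ i ∈ H₂, bucketMass b x₀ ν i) (hn : 0 < n) {X Y : Fin n → ℝ}
    (hX : empiricalDeviation (μ.map (bucket b x₀)) H₁ (fun j => bucket b x₀ (X j)) ≤ ε / 16)
    (hY : empiricalDeviation (ν.map (bucket b x₀)) H₂ (fun j => bucket b x₀ (Y j)) ≤ ε / 16) :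
    |stva k b x₀ (List.ofFn X) (List.ofFn Y) - tvDist μ ν| < 6 * ε := by
  have hb0 : 0 < b := by rw [hb]; positivity
  obtain ⟨F, hF⟩ : ∃ F, F = coreBuckets b x₀ a R := ⟨_, rfl⟩
  have hstream : ∀ Z : Fin n → ℝ, spaSummary k b x₀ (List.ofFn Z) =
      MMG.run k (List.ofFn fun j => bucket b x₀ (Z j)) := by
    intro Z
    rw [spaSummary_eq_run, List.map_ofFn]
    rfl
  have hne : ∀ y : Fin n → ℤ, List.ofFn y ≠ [] := by
    intro y h
    have := congrArg List.length h
    simp at this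
    omega
  obtain ⟨s, hs⟩ : ∃ s, s = MMG.run k (List.ofFn fun j => bucket b x₀ (X j)) := ⟨_, rfl⟩
  obtain ⟨t, ht⟩ : ∃ t, t = MMG.run k (List.ofFn fun j => bucket b x₀ (Y j)) := ⟨_, rfl⟩
  obtain ⟨G, hG⟩ : ∃ G, G = F ∪ H₁ ∪ H₂ ∪ s.tracked ∪ t.tracked := ⟨_, rfl⟩
  have hFG : F ⊆ G := fun i hi => by simp [hG, hi]
  have hH₁G : H₁ ⊆ G := fun i hi => by simp [hG, hi]
  have hH₂G : H₂ ⊆ G := fun i hi => by simp [hG, hi]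
  have hsG : s.tracked ⊆ G := fun i hi => by simp [hG, hi]
  have htG : t.tracked ⊆ G := fun i hi => by simp [hG, hi]
  have hout : stva k b x₀ (List.ofFn X) (List.ofFn Y) =
      1 / 2 * ∑ i ∈ G, |spaPDF s i - spaPDF t i| := by
    rw [stva, hstream, hstream, ← hs, ← ht, stvaOutput_eq hsG htG]
  have h1 : ∑ i ∈ G, |spaPDF s i - bucketMass b x₀ μ i| ≤ 6 * (ε / 16 + ε / 16) := by
    rw [hs] at hsG ⊢
    refine sum_abs_spaPDF_sub_mass_le (hne _) (by omega) (bucketMass_nonneg b x₀ μ)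
      (sum_bucketMass_le_one b x₀ μ) hH₁ ?_ (by linarith) hsG hH₁G
    rw [List.length_ofFn]
    exact hX
  have h2 : ∑ i ∈ G, |spaPDF t i - bucketMass b x₀ ν i| ≤ 6 * (ε / 16 + ε / 16) := by
    rw [ht] at htG ⊢
    refine sum_abs_spaPDF_sub_mass_le (hne _) (by omega) (bucketMass_nonneg b x₀ ν)
      (sum_bucketMass_le_one b x₀ ν) hH₂ ?_ (by linarith) htG hH₂G
    rw [List.length_ofFn]
    exact hY
  have h3 : |(∑ i ∈ G, |spaPDF s i - spaPDF t i|) -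
      (∑ i ∈ G, |bucketMass b x₀ μ i - bucketMass b x₀ ν i|)| ≤ 12 * (ε / 16 + ε / 16) := by
    rw [← Finset.sum_sub_distrib]
    refine (Finset.abs_sum_le_sum_abs _ _).trans ?_
    calc _ ≤ ∑ i ∈ G, (|spaPDF s i - bucketMass b x₀ μ i| +
          |spaPDF t i - bucketMass b x₀ ν i|) := by
          refine Finset.sum_le_sum fun i _ => (abs_abs_sub_abs_le_abs_sub _ _).trans ?_
          rw [sub_sub_sub_comm]
          exact abs_sub _ _
      _ ≤ _ := by rw [Finset.sum_add_distrib]; linarith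
  have h4 := half_sum_abs_bucketMass_sub_le b x₀ μ ν G
  have h5 := tvDist_le_half_sum_abs_bucketMass_sub hμ hν hℓ hb0 x₀ hFG
  have h6 : μ.real {x | bucket b x₀ x ∉ F} ≤ ε := by
    rw [hF]; exact (measureReal_notMem_coreBuckets_le hb0 x₀ a R μ).trans ha
  have h7 : ν.real {x | bucket b x₀ x ∉ G} ≤ ε / 16 := by
    rw [measureReal_bucket_notMem]
    have := Finset.sum_le_sum_of_subset_of_nonneg hH₂G
      fun i _ _ => bucketMass_nonneg b x₀ ν i
    linarith
  have hbR : ℓ * b * R = ε := by rw [hb]; field_simp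
  have hble : ℓ * b ^ 2 ≤ ε := by
    have h := hμ.le_mul_sq hℓ hR hε6 ha
    have hbR' : b ≤ R := by
      rw [hb, div_le_iff₀ (by positivity)]
      linarith [show R * (ℓ * R) = ℓ * R ^ 2 by ring]
    calc ℓ * b ^ 2 = ℓ * b * b := by ring
      _ ≤ ℓ * b * R := by gcongr
      _ = ε := hbR
  have h8 : F.card * (ℓ * b ^ 2) ≤ 4 * ε := by
    have hc := card_coreBuckets_le hb0 x₀ a hR.le
    rw [← hF] at hc
    calc F.card * (ℓ * b ^ 2) ≤ (2 * R / b + 2) * (ℓ * b ^ 2) := by gcongr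
      _ = 2 * (ℓ * b * R) + 2 * (ℓ * b ^ 2) := by field_simp
      _ ≤ 4 * ε := by rw [hbR]; linarith
  rw [hout]
  rw [abs_le] at h3
  rw [abs_lt]
  constructor <;> linarith [h3.1, h3.2]

/-- The guarantee of the estimator, from bucket sets `H₁`, `H₂` that carry almost all of the mass,
are small compared with the number of counters, and whose frequencies can be learned from `n`
samples. -/
theorem stvaGuarantee_of_bucketSets {μ ν : Measure ℝ} [IsProbabilityMeasure μ]
    [IsProbabilityMeasure ν] {ℓ ε δ R a x₀ : ℝ} {k n : ℕ} (hμ : HasLipschitzPDF μ ℓ)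
    (hν : HasLipschitzPDF ν ℓ) (hℓ : 0 < ℓ) (hε : 0 < ε) (hε6 : ε ≤ 1 / 6) (hδ : 0 < δ)
    (hδ4 : δ ≤ 1 / 4) (hR : 0 < R) (ha : μ.real {x | R ≤ |x - a|} ≤ ε)
    {b : ℝ} (hb : b = ε / (ℓ * R)) {H₁ H₂ : Finset ℤ} (hk₁ : 4 * H₁.card ≤ k)
    (hk₂ : 4 * H₂.card ≤ k) (hH₁ : 1 - ε / 16 ≤ ∑ i ∈ H₁, bucketMass b x₀ μ i)
    (hH₂ : 1 - ε / 16 ≤ ∑ i ∈ H₂, bucketMass b x₀ ν i)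
    (hV₁ : ∑ i ∈ H₁, √(bucketMass b x₀ μ i) ≤ ε / 32 * √n)
    (hV₂ : ∑ i ∈ H₂, √(bucketMass b x₀ ν i) ≤ ε / 32 * √n)
    (hn : 8192 * (1 / ε ^ 2 * Real.log (1 / δ)) ≤ n)
    {Ω : Type*} [MeasurableSpace Ω] {P : Measure Ω} [IsProbabilityMeasure P]
    {X Y : Fin n → Ω → ℝ} (hX : IsIIDSample P X μ) (hY : IsIIDSample P Y ν) :
    STVAGuarantee P X Y μ ν k b x₀ ε δ := by
  have hδlog : 0 < Real.log (1 / δ) := Real.log_pos (by rw [lt_div_iff₀ hδ]; linarith)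
  have hn0 : 0 < n := by
    have : (0 : ℝ) < n := lt_of_lt_of_le (by positivity) hn
    exact_mod_cast this
  have hk0 : 0 < k := by
    have : 0 < H₁.card := by
      rw [Finset.card_pos, Finset.nonempty_iff_ne_empty]
      rintro rfl
      rw [Finset.sum_empty] at hH₁
      linarith
    omega
  refine ⟨fun ω m _ => ?_, ?_⟩
  · rw [spaSummary_eq_run, spaSummary_eq_run]
    exact ⟨MMG.card_tracked_run_le hk0 _, MMG.card_tracked_run_le hk0 _⟩
  -- Mean and fluctuation of the empirical deviation get `ε / 32` each, whence `8192 = 8 * 32 ^ 2`.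
  have hexp : Real.exp (-(n * (ε / 32) ^ 2 / 8)) ≤ δ := by
    rw [← Real.le_log_iff_exp_le hδ]
    have h1 : Real.log (1 / δ) * 8192 ≤ n * ε ^ 2 := by
      calc Real.log (1 / δ) * 8192 = 8192 * (1 / ε ^ 2 * Real.log (1 / δ)) * ε ^ 2 := by
            field_simp
        _ ≤ n * ε ^ 2 := by gcongr
    rw [one_div, Real.log_inv] at h1
    linarith [show n * (ε / 32) ^ 2 / 8 = n * ε ^ 2 / 8192 by ring]
  have h1 := (hX.measure_empiricalDeviation_ge_le hn0 (measurable_bucket b x₀) H₁ hV₁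
    (t := ε / 32) (by positivity)).trans hexp
  have h2 := (hY.measure_empiricalDeviation_ge_le hn0 (measurable_bucket b x₀) H₂ hV₂
    (t := ε / 32) (by positivity)).trans hexp
  rw [show ε / 32 + ε / 32 = ε / 16 by ring] at h1 h2
  refine (measureReal_mono (s₂ := {ω | ε / 16 ≤ empiricalDeviation (μ.map (bucket b x₀)) H₁
      fun j => bucket b x₀ (X j ω)} ∪ {ω | ε / 16 ≤ empiricalDeviation (ν.map (bucket b x₀)) H₂
      fun j => bucket b x₀ (Y j ω)}) ?_).trans ((measureReal_union_le _ _).trans ?_)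
  · intro ω hω
    by_contra hnot
    simp only [Set.mem_union, Set.mem_ofPred_eq, not_or, not_le] at hnot hω
    have := abs_stva_sub_tvDist_lt hμ hν hℓ hε hε6 hR ha hb hk₁ hk₂ hH₁ hH₂ hn0
      hnot.1.le hnot.2.le
    linarith
  · linarith

/-! ### Sub-Gaussian distributions -/

theorem one_le_log_one_div {ε : ℝ} (hε : 0 < ε) (hε6 : ε ≤ 1 / 6) : 1 ≤ Real.log (1 / ε) := by
  rw [Real.le_log_iff_exp_le (by positivity)]
  have h1 := Real.exp_one_lt_d9
  have h2 : 6 ≤ 1 / ε := by rw [le_div_iff₀ hε]; linarith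
  linarith

theorem log_div_eq {ε c : ℝ} (hε : 0 < ε) (hc : 0 < c) :
    Real.log (c / ε) = Real.log c + Real.log (1 / ε) := by
  rw [← Real.log_mul hc.ne' (by positivity), mul_one_div]

theorem log_div_le_three_mul {ε c : ℝ} (hε : 0 < ε) (hε6 : ε ≤ 1 / 6) (hc : 0 < c)
    (hc36 : c ≤ 36) : Real.log (c / ε) ≤ 3 * Real.log (1 / ε) := by
  have h2 : 6 ≤ 1 / ε := by rw [le_div_iff₀ hε]; linarith
  have h3 : Real.log c ≤ Real.log ((1 / ε) ^ 2) := Real.log_le_log hc (by nlinarith)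
  rw [Real.log_pow] at h3
  rw [log_div_eq hε hc]
  push_cast at h3
  linarith

theorem IsSubGaussian.mono {μ : Measure ℝ} {σ σ' : ℝ} (h : IsSubGaussian μ σ) (hσ : 0 < σ)
    (hσ' : σ ≤ σ') : IsSubGaussian μ σ' := by
  intro t ht
  refine (h t ht).trans ?_
  gcongr

/-- The tail of a sub-Gaussian distribution at radius `σ √(log (c / ε))`. -/
theorem IsSubGaussian.tail_le {μ : Measure ℝ} {σ c ε : ℝ} (h : IsSubGaussian μ σ) (hσ : 0 < σ)
    (hε : 0 < ε) (hc : 0 < c) (hlog : 0 ≤ Real.log (c / ε)) :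
    μ.real {x | σ * √(Real.log (c / ε)) ≤ |x - ∫ y, y ∂μ|} ≤ 2 * (ε / c) := by
  refine (h _ (by positivity)).trans_eq ?_
  rw [mul_pow, Real.sq_sqrt hlog, mul_div_cancel_left₀ _ (by positivity), Real.exp_neg,
    Real.exp_log (by positivity), inv_div]

theorem sum_sqrt_bucketMass_le_sqrt_card (b x₀ : ℝ) (μ : Measure ℝ) [IsProbabilityMeasure μ]
    (H : Finset ℤ) : ∑ i ∈ H, √(bucketMass b x₀ μ i) ≤ √H.card := by
  apply Real.le_sqrt_of_sq_le
  refine sq_sum_le_card_mul_sum_sq.trans ?_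
  simp_rw [Real.sq_sqrt (bucketMass_nonneg b x₀ μ _)]
  exact mul_le_of_le_one_right (by positivity) (sum_bucketMass_le_one b x₀ μ H)

/-- The core buckets of a sub-Gaussian distribution: their number, and their mass. -/
theorem IsSubGaussian.core {μ : Measure ℝ} [IsProbabilityMeasure μ] {σ ℓ ε : ℝ}
    (h : IsSubGaussian μ σ) (hL : HasLipschitzPDF μ ℓ) (hσ : 0 < σ) (hℓ : 0 < ℓ) (hε : 0 < ε)
    (hε6 : ε ≤ 1 / 6) (x₀ : ℝ) :
    ∃ H : Finset ℤ, (H.card : ℝ) ≤ 10 * (σ ^ 2 * ℓ / ε * Real.log (1 / ε)) ∧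
      1 - ε / 16 ≤ ∑ i ∈ H, bucketMass (widthSG ε σ ℓ) x₀ μ i := by
  have hL1 := one_le_log_one_div hε hε6
  have e2 := log_div_le_three_mul hε hε6 (c := 2) (by norm_num) (by norm_num)
  have e32 := log_div_le_three_mul hε hε6 (c := 32) (by norm_num) (by norm_num)
  have p2 : 0 < Real.log (2 / ε) := Real.log_pos (by rw [lt_div_iff₀ hε]; linarith)
  have p32 : 0 < Real.log (32 / ε) := Real.log_pos (by rw [lt_div_iff₀ hε]; linarith)
  have hb : 0 < widthSG ε σ ℓ := by unfold widthSG; positivity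
  have hK : ε ≤ 2 * (σ ^ 2 * ℓ * Real.log (1 / ε)) := by
    have h1 := hL.le_mul_sq hℓ (R := σ * √(Real.log (2 / ε))) (by positivity) hε6
      ((h.tail_le hσ hε (c := 2) (by norm_num) p2.le).trans_eq (by ring))
    rw [mul_pow, Real.sq_sqrt p2.le] at h1
    have h2 : Real.log (2 / ε) ≤ 2 * Real.log (1 / ε) := by
      rw [log_div_eq hε (by norm_num)]
      linarith [Real.log_two_lt_d9]
    calc ε ≤ ℓ * (σ ^ 2 * Real.log (2 / ε)) := h1
      _ ≤ ℓ * (σ ^ 2 * (2 * Real.log (1 / ε))) := by gcongr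
      _ = _ := by ring
  refine ⟨coreBuckets (widthSG ε σ ℓ) x₀ (∫ y, y ∂μ) (σ * √(Real.log (32 / ε))), ?_, ?_⟩
  · refine (card_coreBuckets_le hb x₀ _ (by positivity)).trans ?_
    have h1 : 2 * (σ * √(Real.log (32 / ε))) / widthSG ε σ ℓ =
        2 * (σ ^ 2 * ℓ / ε) * (√(Real.log (32 / ε)) * √(Real.log (2 / ε))) := by
      unfold widthSG
      field_simp
    have h2 : √(Real.log (32 / ε)) * √(Real.log (2 / ε)) ≤ 3 * Real.log (1 / ε) := by
      calc _ ≤ √(3 * Real.log (1 / ε)) * √(3 * Real.log (1 / ε)) := by gcongr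
        _ = _ := Real.mul_self_sqrt (by linarith)
    have h3 : 2 ≤ 4 * (σ ^ 2 * ℓ / ε * Real.log (1 / ε)) := by
      have : 4 * (σ ^ 2 * ℓ / ε * Real.log (1 / ε)) =
          2 * (2 * (σ ^ 2 * ℓ * Real.log (1 / ε))) / ε := by ring
      rw [this, le_div_iff₀ hε]
      linarith
    have h4 : 2 * (σ ^ 2 * ℓ / ε) * (√(Real.log (32 / ε)) * √(Real.log (2 / ε))) ≤
        2 * (σ ^ 2 * ℓ / ε) * (3 * Real.log (1 / ε)) := by gcongr
    rw [h1]
    linarith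
  · have h1 := measureReal_notMem_coreBuckets_le hb x₀ (∫ y, y ∂μ) (σ * √(Real.log (32 / ε))) μ
    rw [measureReal_bucket_notMem] at h1
    linarith [h.tail_le hσ hε (c := 32) (by norm_num) p32.le]

theorem stvaGuarantee_subGaussian {μ ν : Measure ℝ} [IsProbabilityMeasure μ]
    [IsProbabilityMeasure ν] {σ ℓ ε δ : ℝ} (hσ : 0 < σ) (hℓ : 0 < ℓ) (hε : 0 < ε)
    (hε6 : ε ≤ 1 / 6) (hδ : 0 < δ) (hδ4 : δ ≤ 1 / 4) (hμ : IsSubGaussian μ σ)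
    (hν : IsSubGaussian ν σ) (hLμ : HasLipschitzPDF μ ℓ) (hLν : HasLipschitzPDF ν ℓ) {n : ℕ}
    (hn : 10240 * samplesSG ε σ ℓ δ ≤ n) {Ω : Type*} [MeasurableSpace Ω] {P : Measure Ω}
    [IsProbabilityMeasure P] {X Y : Fin n → Ω → ℝ} (hX : IsIIDSample P X μ)
    (hY : IsIIDSample P Y ν) (x₀ : ℝ) :
    STVAGuarantee P X Y μ ν (countersSG 40 ε σ ℓ) (widthSG ε σ ℓ) x₀ ε δ := by
  have hL1 := one_le_log_one_div hε hε6
  have p2 : 0 < Real.log (2 / ε) := Real.log_pos (by rw [lt_div_iff₀ hε]; linarith)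
  obtain ⟨H₁, hc₁, hm₁⟩ := hμ.core hLμ hσ hℓ hε hε6 x₀
  obtain ⟨H₂, hc₂, hm₂⟩ := hν.core hLν hσ hℓ hε hε6 x₀
  have hk : ∀ H : Finset ℤ, (H.card : ℝ) ≤ 10 * (σ ^ 2 * ℓ / ε * Real.log (1 / ε)) →
      4 * H.card ≤ countersSG 40 ε σ ℓ := by
    intro H hH
    have h1 : (4 * H.card : ℝ) ≤ countersSG 40 ε σ ℓ := by
      refine le_trans ?_ (Nat.le_ceil _)
      linarith
    exact_mod_cast h1
  -- `10240 = 10 * 32 ^ 2` turns the bound on the number of core buckets into `∑ √p ≤ ε / 32 * √n`.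
  have hn1 : 10240 * (1 / ε ^ 2 * (σ ^ 2 * ℓ / ε * Real.log (1 / ε))) ≤ n := by
    refine le_trans ?_ hn
    unfold samplesSG
    gcongr
    refine le_trans (le_of_eq ?_) (le_max_left _ _)
    ring
  have hn2 : 10240 * (1 / ε ^ 2 * Real.log (1 / δ)) ≤ n := by
    refine le_trans ?_ hn
    unfold samplesSG
    gcongr
    exact le_max_right _ _
  have hδlog : 0 < Real.log (1 / δ) := Real.log_pos (by rw [lt_div_iff₀ hδ]; linarith)
  have hpos : 0 ≤ 1 / ε ^ 2 * Real.log (1 / δ) := by positivity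
  have hV : ∀ (ρ : Measure ℝ) [IsProbabilityMeasure ρ] (H : Finset ℤ),
      (H.card : ℝ) ≤ 10 * (σ ^ 2 * ℓ / ε * Real.log (1 / ε)) →
      ∑ i ∈ H, √(bucketMass (widthSG ε σ ℓ) x₀ ρ i) ≤ ε / 32 * √n := by
    intro ρ _ H hH
    refine (sum_sqrt_bucketMass_le_sqrt_card _ x₀ ρ H).trans ?_
    rw [Real.sqrt_le_left (by positivity), mul_pow, Real.sq_sqrt (by positivity)]
    have h1 : (ε / 32) ^ 2 * (10240 * (1 / ε ^ 2 * (σ ^ 2 * ℓ / ε * Real.log (1 / ε)))) ≤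
        (ε / 32) ^ 2 * n := by gcongr
    refine hH.trans (le_trans (le_of_eq ?_) h1)
    field_simp
    norm_num
  exact stvaGuarantee_of_bucketSets hLμ hLν hℓ hε hε6 hδ hδ4
    (R := σ * √(Real.log (2 / ε))) (by positivity)
    ((hμ.tail_le hσ hε (c := 2) (by norm_num) p2.le).trans_eq (by ring))
    (by unfold widthSG; congr 1; ring) (hk _ hc₁) (hk _ hc₂) hm₁ hm₂ (hV μ _ hc₁) (hV ν _ hc₂)
    (by linarith) hX hY

/-! ### Sub-Weibull distributions -/

theorem IsSubWeibull.one_le {μ : Measure ℝ} [IsProbabilityMeasure μ] {α c : ℝ}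
    (h : IsSubWeibull μ α c) (hα : 0 < α) : 1 ≤ c := by
  have h0 := h 0 le_rfl
  have huniv : {x : ℝ | 0 ≤ |x|} = Set.univ := by ext x; simp
  rw [huniv, probReal_univ, Real.zero_rpow (by positivity)] at h0
  simpa using h0

/-- The tail of a sub-Weibull distribution at radius `(log (c' / ε)) ^ α`. -/
theorem IsSubWeibull.tail_le {μ : Measure ℝ} {α c c' ε : ℝ} (h : IsSubWeibull μ α c)
    (hα : 0 < α) (hε : 0 < ε) (hc : 0 < c') (hlog : 0 ≤ Real.log (c' / ε)) :
    μ.real {x | Real.log (c' / ε) ^ α ≤ |x - 0|} ≤ c * (ε / c') := by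
  simp_rw [sub_zero]
  refine (h _ (by positivity)).trans_eq ?_
  rw [one_div, Real.rpow_rpow_inv hlog hα.ne', Real.exp_neg, Real.exp_log (by positivity), inv_div]

/-- The second moments of all sub-Weibull distributions with the same parameters are uniformly
bounded, by integrating the tail bound. -/
theorem exists_lintegral_sq_le {α c : ℝ} (hα : 0 < α) (hc : 0 < c) :
    ∃ M : ℝ, 0 ≤ M ∧ ∀ μ : Measure ℝ, [IsProbabilityMeasure μ] → IsSubWeibull μ α c →
      ∫⁻ x, ENNReal.ofReal (|x| ^ (2 : ℝ)) ∂μ ≤ ENNReal.ofReal M := by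
  obtain ⟨J, hJ⟩ : ∃ J, J = ENNReal.ofReal 2 * ∫⁻ t in Set.Ioi (0 : ℝ),
    ENNReal.ofReal (c * Real.exp (-(t ^ (1 / α)))) * ENNReal.ofReal (t ^ ((2 : ℝ) - 1)) := ⟨_, rfl⟩
  have hfin : J ≠ ⊤ := by
    rw [hJ]
    refine ENNReal.mul_ne_top ENNReal.ofReal_ne_top ?_
    have hi := (integrableOn_rpow_mul_exp_neg_rpow (p := 1 / α) (s := 1) (by norm_num)
      (by positivity)).const_mul c
    refine ne_top_of_le_ne_top hi.lintegral_lt_top.ne (le_of_eq ?_)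
    refine setLIntegral_congr_fun measurableSet_Ioi fun t ht => ?_
    have ht : (0 : ℝ) < t := ht
    rw [← ENNReal.ofReal_mul (by positivity)]
    congr 1
    norm_num
    ring
  refine ⟨J.toReal, ENNReal.toReal_nonneg, fun μ _ h => ?_⟩
  rw [ENNReal.ofReal_toReal hfin, hJ, lintegral_rpow_eq_lintegral_meas_le_mul μ
    (ae_of_all _ fun x => abs_nonneg x) (by fun_prop) (by norm_num)]
  refine mul_le_mul' le_rfl ?_
  refine setLIntegral_mono_ae' measurableSet_Ioi (ae_of_all _ fun t ht => ?_)
  gcongr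
  rw [← ofReal_measureReal]
  exact ENNReal.ofReal_le_ofReal (h t (le_of_lt ht))

/-- The sum is compared with the telescoping sum of the differences of `(1 + j β)⁻¹ / β`. -/
theorem sum_range_inv_sq_le {β : ℝ} (hβ : 0 < β) (N : ℕ) :
    ∑ j ∈ Finset.range N, ((1 + j * β) ^ 2)⁻¹ ≤ 1 + 1 / β := by
  have key : ∀ N : ℕ, ∑ j ∈ Finset.range (N + 1), ((1 + j * β) ^ 2)⁻¹ ≤
      1 + 1 / β * (1 - (1 + N * β)⁻¹) := by
    intro N
    induction N with
    | zero => simp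
    | succ N ih =>
      rw [Finset.sum_range_succ]
      have h1 : ((1 + ((N + 1 : ℕ) : ℝ) * β) ^ 2)⁻¹ ≤
          1 / β * ((1 + N * β)⁻¹ - (1 + ((N + 1 : ℕ) : ℝ) * β)⁻¹) := by
        have e : 1 / β * ((1 + N * β)⁻¹ - (1 + ((N + 1 : ℕ) : ℝ) * β)⁻¹) =
            ((1 + N * β) * (1 + ((N + 1 : ℕ) : ℝ) * β))⁻¹ := by
          have : 0 < 1 + N * β := by positivity
          have : 0 < 1 + ((N + 1 : ℕ) : ℝ) * β := by positivity
          field_simp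
          push_cast
          ring
        rw [e, sq]
        gcongr
        linarith
      linarith
  cases N with
  | zero => rw [Finset.sum_range_zero]; positivity
  | succ N =>
    refine (key N).trans ?_
    have : 0 ≤ 1 / β * (1 + N * β)⁻¹ := by positivity
    linarith

theorem sum_inv_sq_natAbs_le {β : ℝ} (hβ : 0 < β) (i₀ : ℤ) (H : Finset ℤ) :
    ∑ i ∈ H, ((1 + (i - i₀).natAbs * β) ^ 2)⁻¹ ≤ 2 + 2 / β := by
  obtain ⟨N, hN⟩ : ∃ N, N = H.sup (fun i => (i - i₀).natAbs) + 1 := ⟨_, rfl⟩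
  have hmaps : ∀ i ∈ H, (i - i₀).natAbs ∈ Finset.range N := by
    intro i hi
    have := Finset.le_sup (f := fun i => (i - i₀).natAbs) hi
    rw [Finset.mem_range, hN]
    exact Nat.lt_succ_of_le this
  rw [← Finset.sum_fiberwise_of_maps_to hmaps]
  calc _ ≤ ∑ j ∈ Finset.range N, 2 * ((1 + j * β) ^ 2)⁻¹ := by
        refine Finset.sum_le_sum fun j _ => ?_
        rw [Finset.sum_congr rfl (g := fun _ => ((1 + j * β) ^ 2)⁻¹) fun i hi => by
          rw [(Finset.mem_filter.1 hi).2], Finset.sum_const, nsmul_eq_mul]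
        gcongr
        have hsub : H.filter (fun i => (i - i₀).natAbs = j) ⊆ {i₀ + j, i₀ - j} := by
          intro i hi
          have := (Finset.mem_filter.1 hi).2
          simp only [Finset.mem_insert, Finset.mem_singleton]
          omega
        exact_mod_cast (Finset.card_le_card hsub).trans Finset.card_le_two
    _ ≤ 2 + 2 / β := by
        rw [← Finset.mul_sum]
        have := sum_range_inv_sq_le hβ N
        calc _ ≤ 2 * (1 + 1 / β) := by gcongr
          _ = _ := by ring

/-- The weighted bucket masses, with quadratically growing weights, are bounded by the second
moment. -/
theorem sum_weight_mul_bucketMass_le {μ : Measure ℝ} [IsProbabilityMeasure μ] {M : ℝ}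
    (hM0 : 0 ≤ M) (hM : ∫⁻ x, ENNReal.ofReal (|x| ^ (2 : ℝ)) ∂μ ≤ ENNReal.ofReal M) {b : ℝ}
    (hb : 0 < b) (x₀ : ℝ) (H : Finset ℤ) :
    ∑ i ∈ H, (1 + (i - bucket b x₀ 0).natAbs * b) ^ 2 * bucketMass b x₀ μ i ≤
      2 * (1 + b) ^ 2 + 2 * M := by
  have hsq : ∀ x : ℝ, |x| ^ (2 : ℝ) = x ^ 2 := fun x => by
    rw [Real.rpow_two, sq_abs]
  simp_rw [hsq] at hM
  have hint : Integrable (fun x : ℝ => x ^ 2) μ := by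
    refine ⟨by fun_prop, ?_⟩
    rw [hasFiniteIntegral_iff_ofReal (ae_of_all _ fun x => sq_nonneg x)]
    exact hM.trans_lt ENNReal.ofReal_lt_top
  have hmom : ∫ x, x ^ 2 ∂μ ≤ M := by
    rw [integral_eq_lintegral_of_nonneg_ae (ae_of_all _ fun x => sq_nonneg x) (by fun_prop)]
    exact ENNReal.toReal_le_of_le_ofReal hM0 hM
  have hms : ∀ i : ℤ, MeasurableSet (bucket b x₀ ⁻¹' {i}) := fun i =>
    measurable_bucket b x₀ (measurableSet_singleton i)
  have hterm : ∀ i : ℤ, (1 + ((i - bucket b x₀ 0).natAbs : ℝ) * b) ^ 2 * bucketMass b x₀ μ i =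
      ∫ x, (bucket b x₀ ⁻¹' {i}).indicator
        (fun _ => (1 + ((i - bucket b x₀ 0).natAbs : ℝ) * b) ^ 2) x ∂μ := by
    intro i
    rw [integral_indicator_const _ (hms i), smul_eq_mul, bucketMass_eq, mul_comm]
  have hdist : ∀ x, ((bucket b x₀ x - bucket b x₀ 0).natAbs : ℝ) * b ≤ |x| + b := by
    intro x
    rw [Nat.cast_natAbs, Int.cast_abs, Int.cast_sub, ← abs_of_pos hb, ← abs_mul, abs_of_pos hb]
    have h1 : (bucket b x₀ x : ℝ) ≤ (x - x₀) / b := Int.floor_le _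
    have h2 : (x - x₀) / b < bucket b x₀ x + 1 := Int.lt_floor_add_one _
    have h3 : (bucket b x₀ 0 : ℝ) ≤ (0 - x₀) / b := Int.floor_le _
    have h4 : (0 - x₀) / b < bucket b x₀ 0 + 1 := Int.lt_floor_add_one _
    rw [le_div_iff₀ hb] at h1 h3
    rw [div_lt_iff₀ hb] at h2 h4
    rw [abs_le]
    constructor <;> linarith [le_abs_self x, neg_abs_le x]
  simp_rw [hterm]
  rw [← integral_finsetSum _ fun i _ => (integrable_const _).indicator (hms i)]
  calc _ ≤ ∫ x, (2 * (1 + b) ^ 2 + 2 * x ^ 2) ∂μ := by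
        refine integral_mono (integrable_finsetSum _ fun i _ =>
          (integrable_const _).indicator (hms i))
          ((integrable_const _).add (hint.const_mul 2)) fun x => ?_
        have hind : ∀ i : ℤ, (bucket b x₀ ⁻¹' {i}).indicator
            (fun _ => (1 + ((i - bucket b x₀ 0).natAbs : ℝ) * b) ^ 2) x =
            if bucket b x₀ x = i then (1 + ((i - bucket b x₀ 0).natAbs : ℝ) * b) ^ 2 else 0 := by
          intro i
          by_cases h : bucket b x₀ x = i <;> simp [Set.indicator, h]
        simp only [hind]
        rw [Finset.sum_ite_eq]
        split_ifs
        · calc (1 + ((bucket b x₀ x - bucket b x₀ 0).natAbs : ℝ) * b) ^ 2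
              ≤ (1 + (|x| + b)) ^ 2 := by gcongr; exact hdist x
            _ ≤ _ := by
              rw [← sq_abs x]
              nlinarith [sq_nonneg (1 + b - |x|)]
        · positivity
    _ ≤ _ := by
        rw [integral_add (integrable_const _) (hint.const_mul 2)]
        simp only [integral_const, probReal_univ, one_smul, integral_const_mul]
        gcongr

/-- Cauchy–Schwarz with quadratically growing weights: the sum of the square roots of the bucket
masses is of order `b ^ (-1/2)`, however many buckets carry mass. -/
theorem sum_sqrt_bucketMass_le {μ : Measure ℝ} [IsProbabilityMeasure μ] {M : ℝ}
    (hM0 : 0 ≤ M) (hM : ∫⁻ x, ENNReal.ofReal (|x| ^ (2 : ℝ)) ∂μ ≤ ENNReal.ofReal M) {b : ℝ}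
    (hb : 0 < b) (x₀ : ℝ) (H : Finset ℤ) :
    ∑ i ∈ H, √(bucketMass b x₀ μ i) ≤ √((2 * (1 + b) ^ 2 + 2 * M) * (2 + 2 / b)) := by
  rw [Real.sqrt_mul (by positivity)]
  have hw : ∀ i : ℤ, (0 : ℝ) < (1 + ((i - bucket b x₀ 0).natAbs : ℝ) * b) ^ 2 := fun i => by
    positivity
  calc ∑ i ∈ H, √(bucketMass b x₀ μ i)
      = ∑ i ∈ H, √((1 + ((i - bucket b x₀ 0).natAbs : ℝ) * b) ^ 2 * bucketMass b x₀ μ i) *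
          √(((1 + ((i - bucket b x₀ 0).natAbs : ℝ) * b) ^ 2)⁻¹) := by
        refine Finset.sum_congr rfl fun i _ => ?_
        rw [← Real.sqrt_mul (mul_nonneg (hw i).le (bucketMass_nonneg _ _ _ _)), mul_right_comm,
          mul_inv_cancel₀ (hw i).ne', one_mul]
    _ ≤ _ := Real.sum_sqrt_mul_sqrt_le H
        (fun i => mul_nonneg (hw i).le (bucketMass_nonneg _ _ _ _))
        (fun i => (inv_pos.2 (hw i)).le)
    _ ≤ _ := by
        gcongr
        · exact sum_weight_mul_bucketMass_le hM0 hM hb x₀ H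
        · exact sum_inv_sq_natAbs_le hb _ H

theorem log_div_le_mul_log {ε c c' : ℝ} (hε : 0 < ε) (hε6 : ε ≤ 1 / 6) (hc : 0 < c)
    (hcc' : c ≤ c') (hc' : 1 ≤ c') :
    Real.log (c / ε) ≤ (1 + Real.log c') * Real.log (1 / ε) := by
  have h1 := one_le_log_one_div hε hε6
  have h2 := Real.log_nonneg hc'
  have h3 := Real.log_le_log hc hcc'
  rw [log_div_eq hε hc]
  nlinarith

/-- The core buckets of a sub-Weibull distribution: their number, and their mass. -/
theorem IsSubWeibull.core {μ : Measure ℝ} [IsProbabilityMeasure μ] {α c ℓ ε : ℝ} (hα : 0 < α)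
    (h : IsSubWeibull μ α c) (hL : HasLipschitzPDF μ ℓ) (hℓ : 0 < ℓ) (hε : 0 < ε)
    (hε6 : ε ≤ 1 / 6) (x₀ : ℝ) :
    ∃ H : Finset ℤ, (H.card : ℝ) ≤ 4 * (1 + Real.log (16 * c)) ^ (2 * α) *
        (ℓ / ε * Real.log (1 / ε) ^ (2 * α)) ∧
      1 - ε / 16 ≤ ∑ i ∈ H, bucketMass (widthSW ε α c ℓ) x₀ μ i := by
  have hc := h.one_le hα
  have hL1 := one_le_log_one_div hε hε6
  have p2 : 0 < Real.log (2 * c / ε) := Real.log_pos (by rw [lt_div_iff₀ hε]; linarith)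
  have p16 : 0 < Real.log (16 * c / ε) := Real.log_pos (by rw [lt_div_iff₀ hε]; linarith)
  have e2 := log_div_le_mul_log hε hε6 (c := 2 * c) (c' := 16 * c) (by linarith) (by linarith)
    (by linarith)
  have e16 := log_div_le_mul_log hε hε6 (c := 16 * c) (c' := 16 * c) (by linarith) le_rfl
    (by linarith)
  obtain ⟨κ, hκ⟩ : ∃ κ, κ = 1 + Real.log (16 * c) := ⟨_, rfl⟩
  have hκ1 : 1 ≤ κ := by
    have := Real.log_nonneg (show 1 ≤ 16 * c by linarith)
    linarith
  rw [← hκ] at e2 e16 ⊢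
  have hb : 0 < widthSW ε α c ℓ := by unfold widthSW; positivity
  have hpow : ∀ u v : ℝ, 0 < u → 0 < v → u ≤ κ * Real.log (1 / ε) → v ≤ κ * Real.log (1 / ε) →
      u ^ α * v ^ α ≤ κ ^ (2 * α) * Real.log (1 / ε) ^ (2 * α) := by
    intro u v hu hv hu' hv'
    calc u ^ α * v ^ α ≤ (κ * Real.log (1 / ε)) ^ α * (κ * Real.log (1 / ε)) ^ α := by gcongr
      _ = _ := by
        rw [← Real.rpow_add (by positivity), ← two_mul,
          Real.mul_rpow (by linarith) (by linarith)]
  have hK : ε ≤ ℓ * (κ ^ (2 * α) * Real.log (1 / ε) ^ (2 * α)) := by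
    have ht := h.tail_le hα hε (c' := 2 * c) (by linarith) p2.le
    have h1 := hL.le_mul_sq hℓ (R := Real.log (2 * c / ε) ^ α) (by positivity) hε6
      (ht.trans (by rw [show c * (ε / (2 * c)) = ε / 2 by field_simp]; linarith))
    rw [sq] at h1
    refine h1.trans (mul_le_mul_of_nonneg_left ?_ hℓ.le)
    exact hpow _ _ p2 p2 e2 e2
  refine ⟨coreBuckets (widthSW ε α c ℓ) x₀ 0 (Real.log (16 * c / ε) ^ α), ?_, ?_⟩
  · refine (card_coreBuckets_le hb x₀ _ (by positivity)).trans ?_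
    have h1 : 2 * (Real.log (16 * c / ε) ^ α) / widthSW ε α c ℓ =
        2 * (ℓ / ε) * (Real.log (16 * c / ε) ^ α * Real.log (2 * c / ε) ^ α) := by
      unfold widthSW
      field_simp
    have h3 : 2 ≤ 2 * (ℓ / ε) * (κ ^ (2 * α) * Real.log (1 / ε) ^ (2 * α)) := by
      have : 2 * (ℓ / ε) * (κ ^ (2 * α) * Real.log (1 / ε) ^ (2 * α)) =
          2 * (ℓ * (κ ^ (2 * α) * Real.log (1 / ε) ^ (2 * α))) / ε := by ring
      rw [this, le_div_iff₀ hε]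
      linarith
    have h4 : 2 * (ℓ / ε) * (Real.log (16 * c / ε) ^ α * Real.log (2 * c / ε) ^ α) ≤
        2 * (ℓ / ε) * (κ ^ (2 * α) * Real.log (1 / ε) ^ (2 * α)) := by
      refine mul_le_mul_of_nonneg_left ?_ (by positivity)
      exact hpow _ _ p16 p2 e16 e2
    rw [h1]
    calc _ ≤ 2 * (ℓ / ε) * (κ ^ (2 * α) * Real.log (1 / ε) ^ (2 * α)) +
          2 * (ℓ / ε) * (κ ^ (2 * α) * Real.log (1 / ε) ^ (2 * α)) := by linarith
      _ = _ := by ring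
  · have h1 := measureReal_notMem_coreBuckets_le hb x₀ 0 (Real.log (16 * c / ε) ^ α) μ
    rw [measureReal_bucket_notMem] at h1
    have h2 := h.tail_le hα hε (c' := 16 * c) (by linarith) p16.le
    rw [show c * (ε / (16 * c)) = ε / 16 by field_simp] at h2
    linarith

/-- The bucket width is bounded in terms of `α` and `c`. The radius for `ε = 1 / 6` gives a lower
bound on `ℓ`. -/
theorem widthSW_le {μ : Measure ℝ} [IsProbabilityMeasure μ] {α c ℓ ε : ℝ} (hα : 0 < α)
    (h : IsSubWeibull μ α c) (hL : HasLipschitzPDF μ ℓ) (hℓ : 0 < ℓ) (hε : 0 < ε)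
    (hε6 : ε ≤ 1 / 6) : widthSW ε α c ℓ ≤ Real.log (12 * c) ^ α := by
  have hc := h.one_le hα
  have p12 : 0 < Real.log (12 * c) := Real.log_pos (by linarith)
  have e : 2 * c / (1 / 6) = 12 * c := by ring
  have ht := h.tail_le hα (ε := 1 / 6) (c' := 2 * c) (by norm_num) (by linarith)
    (by rw [e]; exact p12.le)
  rw [e, show c * (1 / 6 / (2 * c)) = 1 / 12 by field_simp; norm_num] at ht
  have h1 := hL.le_mul_sq hℓ (ε := 1 / 6) (by positivity) le_rfl (ht.trans (by norm_num))
  have h2 : Real.log (12 * c) ^ α ≤ Real.log (2 * c / ε) ^ α := by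
    gcongr
    rw [le_div_iff₀ hε]
    nlinarith
  have p2 : 0 < Real.log (12 * c) ^ α := by positivity
  unfold widthSW
  rw [div_le_iff₀ (mul_pos hℓ (p2.trans_le h2))]
  calc ε ≤ ℓ * (Real.log (12 * c) ^ α) ^ 2 := hε6.trans h1
    _ = Real.log (12 * c) ^ α * (ℓ * Real.log (12 * c) ^ α) := by ring
    _ ≤ _ := by gcongr

theorem exists_stvaGuarantee_subWeibull {α c : ℝ} (hα : 0 < α) (hc0 : 0 < c) :
    ∃ Cn > (0 : ℝ), ∃ Ck > (0 : ℝ), ∀ {ℓ ε δ : ℝ}, 0 < ℓ → 0 < ε → ε ≤ 1 / 6 → 0 < δ →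
      δ ≤ 1 / 4 → ∀ (μ ν : Measure ℝ) [IsProbabilityMeasure μ] [IsProbabilityMeasure ν],
      IsSubWeibull μ α c → IsSubWeibull ν α c → HasLipschitzPDF μ ℓ → HasLipschitzPDF ν ℓ →
      ∀ n : ℕ, Cn * samplesSW ε α ℓ δ ≤ n →
      ∀ (Ω : Type u) [MeasurableSpace Ω] (P : Measure Ω) [IsProbabilityMeasure P]
        (X Y : Fin n → Ω → ℝ), IsIIDSample P X μ → IsIIDSample P Y ν → ∀ x₀ : ℝ,
      STVAGuarantee P X Y μ ν (countersSW Ck ε α ℓ) (widthSW ε α c ℓ) x₀ ε δ := by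
  -- For `c < 1` there are no such distributions, and any constants do.
  rcases lt_or_ge c 1 with hc1 | hc
  · refine ⟨1, one_pos, 1, one_pos, fun _ _ _ _ _ μ ν _ _ hμ => ?_⟩
    exact absurd (hμ.one_le hα) (not_le.2 hc1)
  obtain ⟨M, hM0, hM⟩ := exists_lintegral_sq_le hα hc0
  obtain ⟨κ, hκ⟩ : ∃ κ, κ = 1 + Real.log (16 * c) := ⟨_, rfl⟩
  have hκ1 : 1 ≤ κ := by
    have := Real.log_nonneg (show 1 ≤ 16 * c by linarith)
    linarith
  obtain ⟨R₀, hR₀⟩ : ∃ R₀, R₀ = Real.log (12 * c) ^ α := ⟨_, rfl⟩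
  have hR₀pos : 0 < R₀ := by
    have : 0 < Real.log (12 * c) := Real.log_pos (by linarith)
    rw [hR₀]; positivity
  obtain ⟨Γ, hΓ⟩ : ∃ Γ, Γ = Real.Gamma (1 + α) := ⟨_, rfl⟩
  have hΓ0 : 0 < Γ := by rw [hΓ]; exact Real.Gamma_pos_of_pos (by linarith)
  obtain ⟨W, hW⟩ : ∃ W, W = (2 * (1 + R₀) ^ 2 + 2 * M) * (2 * R₀ + 2) * κ ^ α := ⟨_, rfl⟩
  have hW0 : 0 < W := by rw [hW]; positivity
  refine ⟨8192 + 1024 * W / Γ, by positivity, 16 * κ ^ (2 * α), by positivity, ?_⟩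
  intro ℓ ε δ hℓ hε hε6 hδ hδ4 μ ν _ _ hμ hν hLμ hLν n hn Ω _ P _ X Y hX hY x₀
  have hL1 := one_le_log_one_div hε hε6
  have p2 : 0 < Real.log (2 * c / ε) := Real.log_pos (by rw [lt_div_iff₀ hε]; linarith)
  have hδlog : 0 < Real.log (1 / δ) := Real.log_pos (by rw [lt_div_iff₀ hδ]; linarith)
  have hb : 0 < widthSW ε α c ℓ := by unfold widthSW; positivity
  obtain ⟨H₁, hc₁, hm₁⟩ := hμ.core hα hLμ hℓ hε hε6 x₀
  obtain ⟨H₂, hc₂, hm₂⟩ := hν.core hα hLν hℓ hε hε6 x₀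
  have hk : ∀ H : Finset ℤ, (H.card : ℝ) ≤ 4 * (1 + Real.log (16 * c)) ^ (2 * α) *
        (ℓ / ε * Real.log (1 / ε) ^ (2 * α)) →
      4 * H.card ≤ countersSW (16 * κ ^ (2 * α)) ε α ℓ := by
    intro H hH
    rw [← hκ] at hH
    have h1 : (4 * H.card : ℝ) ≤ countersSW (16 * κ ^ (2 * α)) ε α ℓ := by
      refine le_trans ?_ (Nat.le_ceil _)
      linarith
    exact_mod_cast h1
  have hs0 : 0 ≤ samplesSW ε α ℓ δ := by
    unfold samplesSW
    exact mul_nonneg (by positivity) (hδlog.le.trans (le_max_right _ _))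
  have hn1 : 1024 * W * (1 / ε ^ 2 * (ℓ * Real.log (1 / ε) ^ α / ε)) ≤ n := by
    refine le_trans ?_ hn
    have : 1 / ε ^ 2 * (ℓ * Real.log (1 / ε) ^ α / ε * Γ) ≤ samplesSW ε α ℓ δ := by
      unfold samplesSW
      rw [← hΓ]
      gcongr
      exact le_max_left _ _
    calc 1024 * W * (1 / ε ^ 2 * (ℓ * Real.log (1 / ε) ^ α / ε))
        = 1024 * W / Γ * (1 / ε ^ 2 * (ℓ * Real.log (1 / ε) ^ α / ε * Γ)) := by field_simp
      _ ≤ 1024 * W / Γ * samplesSW ε α ℓ δ := by gcongr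
      _ ≤ (8192 + 1024 * W / Γ) * samplesSW ε α ℓ δ := by
        gcongr
        linarith
  have hn2 : 8192 * (1 / ε ^ 2 * Real.log (1 / δ)) ≤ n := by
    refine le_trans ?_ hn
    have : 1 / ε ^ 2 * Real.log (1 / δ) ≤ samplesSW ε α ℓ δ := by
      unfold samplesSW
      gcongr
      exact le_max_right _ _
    calc 8192 * (1 / ε ^ 2 * Real.log (1 / δ)) ≤ 8192 * samplesSW ε α ℓ δ := by gcongr
      _ ≤ (8192 + 1024 * W / Γ) * samplesSW ε α ℓ δ := by
        gcongr
        have : 0 ≤ 1024 * W / Γ := by positivity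
        linarith
  have hbR := widthSW_le hα hμ hLμ hℓ hε hε6
  rw [← hR₀] at hbR
  have hinv : 1 / widthSW ε α c ℓ ≤ κ ^ α * (ℓ * Real.log (1 / ε) ^ α / ε) := by
    have e2 := log_div_le_mul_log hε hε6 (c := 2 * c) (c' := 16 * c) (by linarith) (by linarith)
      (by linarith)
    rw [← hκ] at e2
    calc 1 / widthSW ε α c ℓ = ℓ * Real.log (2 * c / ε) ^ α / ε := by
          unfold widthSW; rw [one_div_div]
      _ ≤ ℓ * (κ * Real.log (1 / ε)) ^ α / ε := by gcongr
      _ = _ := by rw [Real.mul_rpow (by linarith) (by linarith)]; ring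
  have hV : ∀ (ρ : Measure ℝ) [IsProbabilityMeasure ρ] (H : Finset ℤ), IsSubWeibull ρ α c →
      ∑ i ∈ H, √(bucketMass (widthSW ε α c ℓ) x₀ ρ i) ≤ ε / 32 * √n := by
    intro ρ _ H hρ
    refine (sum_sqrt_bucketMass_le hM0 (hM ρ hρ) hb x₀ H).trans ?_
    rw [Real.sqrt_le_left (by positivity), mul_pow, Real.sq_sqrt (by positivity)]
    have h1 : 2 + 2 / widthSW ε α c ℓ ≤ (2 * R₀ + 2) * (1 / widthSW ε α c ℓ) := by
      rw [mul_one_div, add_div]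
      gcongr
      rw [le_div_iff₀ hb]
      linarith
    calc (2 * (1 + widthSW ε α c ℓ) ^ 2 + 2 * M) * (2 + 2 / widthSW ε α c ℓ)
        ≤ (2 * (1 + R₀) ^ 2 + 2 * M) *
          ((2 * R₀ + 2) * (κ ^ α * (ℓ * Real.log (1 / ε) ^ α / ε))) := by
          gcongr
          exact h1.trans (by gcongr)
      _ = (ε / 32) ^ 2 * (1024 * W * (1 / ε ^ 2 * (ℓ * Real.log (1 / ε) ^ α / ε))) := by
          rw [hW]
          field_simp
          norm_num
      _ ≤ (ε / 32) ^ 2 * n := by gcongr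
  have ht := hμ.tail_le hα hε (c' := 2 * c) (by linarith) p2.le
  exact stvaGuarantee_of_bucketSets hLμ hLν hℓ hε hε6 hδ hδ4
    (R := Real.log (2 * c / ε) ^ α) (by positivity)
    (ht.trans (by rw [show c * (ε / (2 * c)) = ε / 2 by field_simp]; linarith))
    rfl (hk _ hc₁) (hk _ hc₂) hm₁ hm₂ (hV μ _ hμ) (hV ν _ hν) hn2 hX hY

/-! ### Error rate and space for a given stream length -/

open Filter Topology in
theorem tendsto_rate (A : ℝ) {θ : ℝ} :
    Tendsto (fun n : ℕ => A * (Real.log n ^ θ / n) ^ (1 / 3 : ℝ)) atTop (𝓝 0) := by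
  have h1 : Tendsto (fun x : ℝ => Real.log x ^ θ / x) atTop (𝓝 0) := by
    simpa using (isLittleO_log_rpow_rpow_atTop θ (s := 1) one_pos).tendsto_div_nhds_zero
  have h2 := (h1.comp tendsto_natCast_atTop_atTop).rpow_const (p := 1 / 3) (Or.inr (by norm_num))
  rw [Real.zero_rpow (by norm_num)] at h2
  simpa using h2.const_mul A

/-- Eventual properties of `ε = A ((log n) ^ θ / n) ^ (1/3)`. -/
theorem eventually_rate {A θ : ℝ} (hA : 1 ≤ A) (hθ : 0 < θ) (C : ℝ) :
    ∃ n₀ : ℕ, ∀ n ≥ n₀, ∀ ε : ℝ, ε = A * (Real.log n ^ θ / n) ^ (1 / 3 : ℝ) →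
      1 ≤ Real.log n ∧ 0 < ε ∧ ε ≤ 1 / 6 ∧ C * ε ≤ 1 ∧
      ε ^ 3 * n = A ^ 3 * Real.log n ^ θ ∧ Real.log (1 / ε) ≤ Real.log n ∧
      1 / ε ≤ (n : ℝ) ^ (1 / 3 : ℝ) * Real.log n ^ (-(θ / 3)) := by
  have h1 : ∀ᶠ n : ℕ in Filter.atTop, A * (Real.log n ^ θ / n) ^ (1 / 3 : ℝ) < 1 / 6 :=
    (tendsto_rate A).eventually_lt_const (by norm_num)
  have h2 : ∀ᶠ n : ℕ in Filter.atTop, C * (A * (Real.log n ^ θ / n) ^ (1 / 3 : ℝ)) < 1 := by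
    have := (tendsto_rate A (θ := θ)).const_mul C
    rw [mul_zero] at this
    exact this.eventually_lt_const (by norm_num)
  have h3 : ∀ᶠ n : ℕ in Filter.atTop, 1 ≤ Real.log n :=
    (Real.tendsto_log_atTop.comp tendsto_natCast_atTop_atTop).eventually_ge_atTop 1
  obtain ⟨n₀, hn₀⟩ := Filter.eventually_atTop.1
    ((h1.and h2).and (h3.and (Filter.eventually_ge_atTop 1)))
  refine ⟨n₀, fun n hn ε hε => ?_⟩
  obtain ⟨⟨e1, e2⟩, e3, e4⟩ := hn₀ n hn
  rw [← hε] at e1 e2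
  have hn1 : (1 : ℝ) ≤ n := by exact_mod_cast e4
  have hn0 : (0 : ℝ) < n := by linarith
  have hL : 0 < Real.log n := by linarith
  have hLθ : 1 ≤ Real.log n ^ θ := Real.one_le_rpow e3 hθ.le
  have hx : 0 < Real.log n ^ θ / n := by positivity
  have hε0 : 0 < ε := by rw [hε]; positivity
  have hinv : 1 / ε ≤ (n : ℝ) ^ (1 / 3 : ℝ) * Real.log n ^ (-(θ / 3)) := by
    have e : (n : ℝ) ^ (1 / 3 : ℝ) * Real.log n ^ (-(θ / 3)) =
        1 / (Real.log n ^ θ / n) ^ (1 / 3 : ℝ) := by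
      rw [Real.div_rpow (by positivity) hn0.le, ← Real.rpow_mul hL.le, one_div_div,
        Real.rpow_neg hL.le, ← div_eq_mul_inv, mul_one_div]
    rw [e, hε]
    gcongr
    exact le_mul_of_one_le_left (by positivity) hA
  refine ⟨e3, hε0, e1.le, e2.le, ?_, ?_, hinv⟩
  · rw [hε, mul_pow, ← Real.rpow_mul_natCast hx.le]
    norm_num
    field_simp
  · refine Real.log_le_log (by positivity) (hinv.trans ?_)
    calc (n : ℝ) ^ (1 / 3 : ℝ) * Real.log n ^ (-(θ / 3)) ≤ (n : ℝ) ^ (1 : ℝ) * 1 := by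
          gcongr
          · norm_num
          · exact Real.rpow_le_one_of_one_le_of_nonpos e3 (by linarith)
      _ = n := by simp

/-- At the error level `ε = A ((log n) ^ θ / n) ^ (1/3)`, a stream of length `n` is long enough. -/
theorem threshold_le_of_rate {A θ ε D V T C : ℝ} {n : ℝ} (hA : 1 ≤ A) (hε : 0 < ε)
    (hθ : 0 ≤ θ) (hlog : 1 ≤ Real.log n) (hCD : C * D * ε ≤ 1) (hC : 0 < C)
    (h3 : ε ^ 3 * n = A ^ 3 * Real.log n ^ θ) (hT : T ≤ V * Real.log n ^ θ / ε)
    (hV : C * V ≤ A ^ 3) : C * (1 / ε ^ 2 * max T D) ≤ n := by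
  have hLθ : 1 ≤ Real.log n ^ θ := Real.one_le_rpow hlog hθ
  have hA3 : 1 ≤ A ^ 3 := one_le_pow₀ hA
  rw [← mul_le_mul_iff_right₀ (show 0 < ε ^ 3 by positivity), h3]
  have e : ε ^ 3 * (C * (1 / ε ^ 2 * max T D)) = C * ε * max T D := by field_simp
  rw [e, mul_max_of_nonneg _ _ (by positivity)]
  apply max_le
  · calc C * ε * T ≤ C * ε * (V * Real.log n ^ θ / ε) := by gcongr
      _ = C * V * Real.log n ^ θ := by field_simp
      _ ≤ A ^ 3 * Real.log n ^ θ := by gcongr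
  · nlinarith

theorem countersSG_le {C ε σ ℓ : ℝ} (h : 0 ≤ C * (σ ^ 2 * ℓ / ε * Real.log (1 / ε))) :
    (countersSG C ε σ ℓ : ℝ) ≤ C * (σ ^ 2 * ℓ / ε * Real.log (1 / ε)) + 1 :=
  (Nat.ceil_lt_add_one h).le

theorem countersSW_le {C ε α ℓ : ℝ} (h : 0 ≤ C * (ℓ / ε * Real.log (1 / ε) ^ (2 * α))) :
    (countersSW C ε α ℓ : ℝ) ≤ C * (ℓ / ε * Real.log (1 / ε) ^ (2 * α)) + 1 :=
  (Nat.ceil_lt_add_one h).le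

theorem one_le_rpow_mul_rpow_log {n : ℕ} (hL : 1 ≤ Real.log n) {s : ℝ} (hs : 0 ≤ s) :
    1 ≤ (n : ℝ) ^ (1 / 3 : ℝ) * Real.log n ^ s := by
  have hn : (1 : ℝ) ≤ n := by
    rcases Nat.eq_zero_or_pos n with rfl | h
    · norm_num at hL
    · exact_mod_cast h
  exact one_le_mul_of_one_le_of_one_le (Real.one_le_rpow hn (by norm_num))
    (Real.one_le_rpow hL hs)

theorem mainTheorem2 :
    -- sub-Gaussian distributions
    (∃ Cn > (0 : ℝ), ∃ Ck > (0 : ℝ),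
      (∀ (σμ σν ℓμ ℓν ε δ : ℝ), 0 < σμ → 0 < σν → 0 < ℓμ → 0 < ℓν →
        0 < ε → ε ≤ 1 / 6 → 0 < δ → δ ≤ 1 / 4 →
        ∀ (μ ν : Measure ℝ) [IsProbabilityMeasure μ] [IsProbabilityMeasure ν],
        IsSubGaussian μ σμ → IsSubGaussian ν σν → HasLipschitzPDF μ ℓμ → HasLipschitzPDF ν ℓν →
        ∀ n : ℕ, Cn * samplesSG ε (max σμ σν) (max ℓμ ℓν) δ ≤ n →
        ∀ (Ω : Type u) [MeasurableSpace Ω] (P : Measure Ω) [IsProbabilityMeasure P]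
          (X Y : Fin n → Ω → ℝ), IsIIDSample P X μ → IsIIDSample P Y ν → ∀ x₀ : ℝ,
        STVAGuarantee P X Y μ ν (countersSG Ck ε (max σμ σν) (max ℓμ ℓν))
          (widthSG ε (max σμ σν) (max ℓμ ℓν)) x₀ ε δ) ∧
      (∀ (σ ℓ : ℝ), 0 < σ → 0 < ℓ → ∃ A > (0 : ℝ), ∃ B > (0 : ℝ),
        ∀ δ : ℝ, 0 < δ → δ ≤ 1 / 4 → ∃ n₀ : ℕ, ∀ n ≥ n₀, ∀ ε : ℝ,
        ε = A * (Real.log n / n) ^ (1 / 3 : ℝ) →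
        0 < ε ∧ ε ≤ 1 / 6 ∧
        (countersSG Ck ε σ ℓ : ℝ) ≤ B * (n : ℝ) ^ (1 / 3 : ℝ) * (Real.log n) ^ (2 / 3 : ℝ) ∧
        ∀ (μ ν : Measure ℝ) [IsProbabilityMeasure μ] [IsProbabilityMeasure ν],
        IsSubGaussian μ σ → IsSubGaussian ν σ → HasLipschitzPDF μ ℓ → HasLipschitzPDF ν ℓ →
        ∀ (Ω : Type u) [MeasurableSpace Ω] (P : Measure Ω) [IsProbabilityMeasure P]
          (X Y : Fin n → Ω → ℝ), IsIIDSample P X μ → IsIIDSample P Y ν → ∀ x₀ : ℝ,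
        STVAGuarantee P X Y μ ν (countersSG Ck ε σ ℓ) (widthSG ε σ ℓ) x₀ ε δ)) ∧
    -- sub-Weibull distributions
    (∀ (α c : ℝ), 0 < α → 0 < c → ∃ Cn > (0 : ℝ), ∃ Ck > (0 : ℝ),
      (∀ (ℓμ ℓν ε δ : ℝ), 0 < ℓμ → 0 < ℓν → 0 < ε → ε ≤ 1 / 6 → 0 < δ → δ ≤ 1 / 4 →
        ∀ (μ ν : Measure ℝ) [IsProbabilityMeasure μ] [IsProbabilityMeasure ν],
        IsSubWeibull μ α c → IsSubWeibull ν α c → HasLipschitzPDF μ ℓμ → HasLipschitzPDF ν ℓν →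
        ∀ n : ℕ, Cn * samplesSW ε α (max ℓμ ℓν) δ ≤ n →
        ∀ (Ω : Type u) [MeasurableSpace Ω] (P : Measure Ω) [IsProbabilityMeasure P]
          (X Y : Fin n → Ω → ℝ), IsIIDSample P X μ → IsIIDSample P Y ν → ∀ x₀ : ℝ,
        STVAGuarantee P X Y μ ν (countersSW Ck ε α (max ℓμ ℓν))
          (widthSW ε α c (max ℓμ ℓν)) x₀ ε δ) ∧
      (∀ ℓ : ℝ, 0 < ℓ → ∃ A > (0 : ℝ), ∃ B > (0 : ℝ),
        ∀ δ : ℝ, 0 < δ → δ ≤ 1 / 4 → ∃ n₀ : ℕ, ∀ n ≥ n₀, ∀ ε : ℝ,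
        ε = A * ((Real.log n) ^ α / n) ^ (1 / 3 : ℝ) →
        0 < ε ∧ ε ≤ 1 / 6 ∧
        (countersSW Ck ε α ℓ : ℝ) ≤
          B * (n : ℝ) ^ (1 / 3 : ℝ) * (Real.log n) ^ (5 * α / 3) ∧
        ∀ (μ ν : Measure ℝ) [IsProbabilityMeasure μ] [IsProbabilityMeasure ν],
        IsSubWeibull μ α c → IsSubWeibull ν α c → HasLipschitzPDF μ ℓ → HasLipschitzPDF ν ℓ →
        ∀ (Ω : Type u) [MeasurableSpace Ω] (P : Measure Ω) [IsProbabilityMeasure P]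
          (X Y : Fin n → Ω → ℝ), IsIIDSample P X μ → IsIIDSample P Y ν → ∀ x₀ : ℝ,
        STVAGuarantee P X Y μ ν (countersSW Ck ε α ℓ) (widthSW ε α c ℓ) x₀ ε δ)) := by
  constructor
  · refine ⟨10240, by norm_num, 40, by norm_num, ?_, ?_⟩
    · intro σμ σν ℓμ ℓν ε δ hσμ hσν hℓμ _ hε hε6 hδ hδ4 μ ν _ _ hμ hν hLμ hLν n hn Ω _ P _ X Y
        hX hY x₀
      exact stvaGuarantee_subGaussian (lt_max_of_lt_left hσμ) (lt_max_of_lt_left hℓμ) hε hε6 hδ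
        hδ4 (hμ.mono hσμ (le_max_left _ _)) (hν.mono hσν (le_max_right _ _))
        (hLμ.mono (le_max_left _ _)) (hLν.mono (le_max_right _ _)) hn hX hY x₀
    · intro σ ℓ hσ hℓ
      have hs : 0 < σ ^ 2 * ℓ := by positivity
      have hA1 : 1 ≤ 1 + 10240 * (σ ^ 2 * ℓ) := by linarith
      refine ⟨1 + 10240 * (σ ^ 2 * ℓ), by positivity, 40 * (σ ^ 2 * ℓ) + 1, by positivity, ?_⟩
      intro δ hδ hδ4
      obtain ⟨n₀, hn₀⟩ := eventually_rate hA1 one_pos (10240 * Real.log (1 / δ))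
      refine ⟨n₀, fun n hn ε hε => ?_⟩
      obtain ⟨hL, hε0, hε6, hCε, h3, hlog, hinv⟩ := hn₀ n hn ε (by rwa [Real.rpow_one])
      have hL0 : 0 < Real.log n := by linarith
      have hlog1 := one_le_log_one_div hε0 hε6
      refine ⟨hε0, hε6, ?_, ?_⟩
      · have h1 : σ ^ 2 * ℓ / ε * Real.log (1 / ε) ≤
            σ ^ 2 * ℓ * ((n : ℝ) ^ (1 / 3 : ℝ) * Real.log n ^ (2 / 3 : ℝ)) := by
          calc σ ^ 2 * ℓ / ε * Real.log (1 / ε) = σ ^ 2 * ℓ * (1 / ε * Real.log (1 / ε)) := by ring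
            _ ≤ σ ^ 2 * ℓ * (((n : ℝ) ^ (1 / 3 : ℝ) * Real.log n ^ (-(1 / 3) : ℝ)) *
                Real.log n ^ (1 : ℝ)) := by
                rw [Real.rpow_one]
                gcongr
            _ = _ := by
                rw [mul_assoc (_ ^ _) (_ ^ _) (_ ^ _), ← Real.rpow_add hL0]
                norm_num
        refine (countersSG_le (by positivity)).trans ?_
        have h2 := one_le_rpow_mul_rpow_log hL (by norm_num : (0 : ℝ) ≤ 2 / 3)
        linarith
      · intro μ ν _ _ hμ hν hLμ hLν Ω _ P _ X Y hX hY x₀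
        refine stvaGuarantee_subGaussian hσ hℓ hε0 hε6 hδ hδ4 hμ hν hLμ hLν ?_ hX hY x₀
        refine threshold_le_of_rate (V := σ ^ 2 * ℓ) hA1 hε0 zero_le_one hL hCε (by norm_num)
          h3 ?_ ?_
        · rw [Real.rpow_one]
          gcongr
        · have := le_self_pow₀ hA1 (n := 3) (by norm_num)
          linarith
  · intro α c hα hc
    obtain ⟨Cn, hCn, Ck, hCk, hmain⟩ := exists_stvaGuarantee_subWeibull.{u} hα hc
    refine ⟨Cn, hCn, Ck, hCk, ?_, ?_⟩
    · intro ℓμ ℓν ε δ hℓμ _ hε hε6 hδ hδ4 μ ν _ _ hμ hν hLμ hLν n hn Ω _ P _ X Y hX hY x₀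
      exact hmain (lt_max_of_lt_left hℓμ) hε hε6 hδ hδ4 μ ν hμ hν (hLμ.mono (le_max_left _ _))
        (hLν.mono (le_max_right _ _)) n hn Ω P X Y hX hY x₀
    · intro ℓ hℓ
      have hΓ : 0 < Real.Gamma (1 + α) := Real.Gamma_pos_of_pos (by linarith)
      have hs : 0 < Cn * (ℓ * Real.Gamma (1 + α)) := by positivity
      have hA1 : 1 ≤ 1 + Cn * (ℓ * Real.Gamma (1 + α)) := by linarith
      refine ⟨1 + Cn * (ℓ * Real.Gamma (1 + α)), by positivity, Ck * ℓ + 1, by positivity, ?_⟩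
      intro δ hδ hδ4
      obtain ⟨n₀, hn₀⟩ := eventually_rate hA1 hα (Cn * Real.log (1 / δ))
      refine ⟨n₀, fun n hn ε hε => ?_⟩
      obtain ⟨hL, hε0, hε6, hCε, h3, hlog, hinv⟩ := hn₀ n hn ε hε
      have hL0 : 0 < Real.log n := by linarith
      have hlog1 := one_le_log_one_div hε0 hε6
      refine ⟨hε0, hε6, ?_, ?_⟩
      · have h1 : ℓ / ε * Real.log (1 / ε) ^ (2 * α) ≤
            ℓ * ((n : ℝ) ^ (1 / 3 : ℝ) * Real.log n ^ (5 * α / 3)) := by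
          calc ℓ / ε * Real.log (1 / ε) ^ (2 * α) = ℓ * (1 / ε * Real.log (1 / ε) ^ (2 * α)) := by
                ring
            _ ≤ ℓ * (((n : ℝ) ^ (1 / 3 : ℝ) * Real.log n ^ (-(α / 3))) *
                Real.log n ^ (2 * α)) := by gcongr
            _ = _ := by
                rw [mul_assoc (_ ^ _) (_ ^ _) (_ ^ _), ← Real.rpow_add hL0]
                ring_nf
        refine (countersSW_le (by positivity)).trans ?_
        have h2 := one_le_rpow_mul_rpow_log hL (by positivity : 0 ≤ 5 * α / 3)
        have h3 := mul_le_mul_of_nonneg_left h1 hCk.le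
        linarith
      · intro μ ν _ _ hμ hν hLμ hLν Ω _ P _ X Y hX hY x₀
        refine hmain hℓ hε0 hε6 hδ hδ4 μ ν hμ hν hLμ hLν n ?_ Ω P X Y hX hY x₀
        refine threshold_le_of_rate (V := ℓ * Real.Gamma (1 + α)) hA1 hε0 hα.le hL hCε hCn
          h3 ?_ ?_
        · rw [div_mul_eq_mul_div, mul_right_comm]
          gcongr
        · have := le_self_pow₀ hA1 (n := 3) (by norm_num)
          linarith
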